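/- Let $n\ge 1$, let $T^n=\mathbb{R}^n/(2\pi\mathbb{Z})^n$, and let $\mathcal{D}'(T^n)$ be the topological dual of the Fréchet space $C^\infty(T^n)$ of smooth complex-valued functions. For $u\in\mathcal{D}'(T^n)$ and $m\in\mathbb{Z}^n$ put $\widehat u(m)=(2\pi)^{-n}\langle u,e^{-i\langle m,\cdot\rangle}\rangle$; write $|m|$ for the Euclidean norm of $m$; the constant $\widehat u(0)$ is the mean of $u$. For $s\ge 0$ and $1\le j\le n$ define $(-\Delta)^s$ and the Riesz transforms $\mathcal{R}_j$ on $\mathcal{D}'(T^n)$ as the Fourier multipliers $$\widehat{(-\Delta)^su}(m)=|m|^{2s}\,\widehat u(m),\qquad \widehat{\mathcal{R}_ju}(m)=i\,\frac{m_j}{|m|}\,\widehat u(m)\quad(m\ne 0),\qquad \widehat{\mathcal{R}_ju}(0)=0 .$$ Let $\dot H^{-n/2}(T^n)$ be the space of all $h\in\mathcal{D}'(T^n)$ with $\widehat h(0)=0$ and $\|h\|_{\dot H^{-n/2}}^2=\sum_{m\ne 0}|m|^{-n}|\widehat h(m)|^2<\infty$, and equip $(L^1+\dot H^{-n/2})(T^n)\subset\mathcal{D}'(T^n)$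 with the norm $$\|v\|_{L^1+\dot H^{-n/2}}=\inf\{\|g\|_{L^1}+\|h\|_{\dot H^{-n/2}}:\ v=g+h,\ g\in L^1(T^n),\ h\in\dot H^{-n/2}(T^n)\}.$$ Then there is a constant $C>0$, depending only on $n$, such that the following holds. Let $u\in\mathcal{D}'(T^n)$ be complex-valued with $$(-\Delta)^{n/4}u\in (L^1+\dot H^{-n/2})(T^n)\quad\text{and}\quad \mathcal{R}_j(-\Delta)^{n/4}u\in (L^1+\dot H^{-n/2})(T^n)\quad\text{for all } j\in\{1,\dots,n\}.$$ Then $u-\widehat u(0)\in L^2_*(T^n)=\{f\in L^2(T^n):\int_{T^n}f\,dx=0\}$ and $$\|u-\widehat u(0)\|_{L^2}\le C\Big(\|(-\Delta)^{n/4}u\|_{L^1+\dot H^{-n/2}}+\sum_{j=1}^n\|\mathcal{R}_j(-\Delta)^{n/4}u\|_{L^1+\dot H^{-n/2}}\Big).$$ -/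

import Mathlib

open MeasureTheory
open scoped ContDiff NNReal ENNReal

namespace TorusDist

noncomputable section

instance factTwoPiPos : Fact (0 < 2 * Real.pi) := ⟨Real.two_pi_pos⟩

/-- The torus `T^n = ℝ^n / (2π ℤ)^n`, with its Lebesgue measure `volume` of mass `(2π)^n`. -/
abbrev Torus (n : ℕ) : Type := Fin n → AddCircle (2 * Real.pi)

/-- The quotient map `ℝ^n → T^n`. -/
def proj {n : ℕ} (x : Fin n → ℝ) : Torus n := fun j => (x j : AddCircle (2 * Real.pi))

/-- The complex-valued functions on `T^n` whose `2π`-periodic lift to `ℝ^n` is smooth. -/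
def smoothSubmodule (n : ℕ) : Submodule ℂ (Torus n → ℂ) where
  carrier := {φ | ContDiff ℝ ∞ (fun x : Fin n → ℝ => φ (proj x))}
  add_mem' := by
    intro f g hf hg
    rw [Set.mem_ofPred_eq] at hf hg ⊢
    exact hf.add hg
  zero_mem' := by
    rw [Set.mem_ofPred_eq]
    exact contDiff_const
  smul_mem' := by
    intro c f hf
    rw [Set.mem_ofPred_eq] at hf ⊢
    exact hf.const_smul c

/-- The space `𝓓(T^n) = C^∞(T^n)` of test functions. -/
def TestFunction (n : ℕ) : Type := smoothSubmodule n

namespace TestFunction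

variable {n : ℕ}

instance : AddCommGroup (TestFunction n) := inferInstanceAs (AddCommGroup (smoothSubmodule n))

instance : Module ℂ (TestFunction n) := inferInstanceAs (Module ℂ (smoothSubmodule n))

instance : FunLike (TestFunction n) (Torus n) ℂ where
  coe φ := φ.1
  coe_injective := Subtype.val_injective

theorem add_apply (φ ψ : TestFunction n) (x : Torus n) : (φ + ψ) x = φ x + ψ x := rfl

theorem smul_apply (c : ℂ) (φ : TestFunction n) (x : Torus n) : (c • φ) x = c * φ x := rfl

/-- The periodic lift of a test function to `ℝ^n`. -/
def lift (φ : TestFunction n) : (Fin n → ℝ) → ℂ := fun x => φ (proj x)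

theorem contDiff_lift (φ : TestFunction n) : ContDiff ℝ ∞ φ.lift := φ.2

theorem lift_add (φ ψ : TestFunction n) : (φ + ψ).lift = φ.lift + ψ.lift := rfl

theorem lift_smul (c : ℂ) (φ : TestFunction n) : (c • φ).lift = c • φ.lift := rfl

theorem lift_zero : (0 : TestFunction n).lift = 0 := rfl

end TestFunction

theorem proj_surjective {n : ℕ} : Function.Surjective (proj (n := n)) := fun y =>
  ⟨fun j => (QuotientAddGroup.mk_surjective (y j)).choose,
    funext fun j => (QuotientAddGroup.mk_surjective (y j)).choose_spec⟩

theorem proj_add {n : ℕ} (x y : Fin n → ℝ) : proj (x + y) = proj x + proj y := rfl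

theorem proj_zero {n : ℕ} : proj (0 : Fin n → ℝ) = 0 := rfl

theorem isOpenQuotientMap_proj {n : ℕ} : IsOpenQuotientMap (proj (n := n)) :=
  IsOpenQuotientMap.piMap (fun _ : Fin n =>
    (QuotientAddGroup.isOpenQuotientMap_mk : IsOpenQuotientMap
      (QuotientAddGroup.mk : ℝ → AddCircle (2 * Real.pi))))

/-- A continuous function on `ℝ^n` which factors through the torus is bounded. -/
theorem bddAbove_range_of_periodic {n : ℕ} {f : (Fin n → ℝ) → ℝ} (hf : Continuous f)
    (hp : ∀ x y, proj x = proj y → f x = f y) : BddAbove (Set.range f) := by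
  obtain ⟨g, hg⟩ : ∃ g : Torus n → ℝ, ∀ x, g (proj x) = f x :=
    ⟨fun y => f (proj_surjective y).choose, fun x => hp _ _ (proj_surjective (proj x)).choose_spec⟩
  have hgc : Continuous g := by
    rw [isOpenQuotientMap_proj.isQuotientMap.continuous_iff]
    exact hf.congr fun x => (hg x).symm
  have hb : BddAbove (Set.range g) := (isCompact_range hgc).bddAbove
  refine hb.mono ?_
  rintro _ ⟨x, rfl⟩
  exact ⟨proj x, hg x⟩

namespace TestFunction

variable {n : ℕ}

theorem continuous (φ : TestFunction n) : Continuous φ := by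
  rw [isOpenQuotientMap_proj.isQuotientMap.continuous_iff]
  exact φ.contDiff_lift.continuous

theorem bddAbove_iteratedFDeriv (φ : TestFunction n) (k : ℕ) :
    BddAbove (Set.range fun x => ‖iteratedFDeriv ℝ k φ.lift x‖) := by
  refine bddAbove_range_of_periodic
    ((φ.contDiff_lift.continuous_iteratedFDeriv (by exact_mod_cast le_top)).norm) ?_
  intro x y hxy
  have hper : (fun z => φ.lift (z + (y - x))) = φ.lift := by
    funext z
    have h0 : proj (y - x) = 0 := by
      have : proj (y - x) = proj y - proj x := rfl
      rw [this, hxy, sub_self]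
    simp [lift, proj_add, h0]
  have h := iteratedFDeriv_comp_add_right (𝕜 := ℝ) (f := φ.lift) k (y - x) x
  rw [hper] at h
  rw [h]
  simp

/-- The seminorm `φ ↦ sup_x ‖D^k φ(x)‖`. -/
def seminorm (n k : ℕ) : Seminorm ℂ (TestFunction n) :=
  Seminorm.ofSMulLE (fun φ => ⨆ x, ‖iteratedFDeriv ℝ k φ.lift x‖)
    (by
      simp only [lift_zero]
      have : iteratedFDeriv ℝ k (0 : (Fin n → ℝ) → ℂ) = 0 := iteratedFDeriv_fun_zero
      simp [this])
    (fun φ ψ => by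
      refine ciSup_le fun x => ?_
      rw [lift_add, iteratedFDeriv_add_apply (φ.contDiff_lift.of_le (by exact_mod_cast le_top)).contDiffAt
        (ψ.contDiff_lift.of_le (by exact_mod_cast le_top)).contDiffAt]
      exact (norm_add_le _ _).trans (add_le_add (le_ciSup (φ.bddAbove_iteratedFDeriv k) x)
        (le_ciSup (ψ.bddAbove_iteratedFDeriv k) x)))
    (fun c φ => by
      refine ciSup_le fun x => ?_
      rw [lift_smul, iteratedFDeriv_const_smul_apply
        (φ.contDiff_lift.of_le (by exact_mod_cast le_top)).contDiffAt, norm_smul]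
      exact mul_le_mul_of_nonneg_left (le_ciSup (φ.bddAbove_iteratedFDeriv k) x) (norm_nonneg c))

theorem norm_iteratedFDeriv_le_seminorm (φ : TestFunction n) (k : ℕ) (x : Fin n → ℝ) :
    ‖iteratedFDeriv ℝ k φ.lift x‖ ≤ seminorm n k φ :=
  le_ciSup (φ.bddAbove_iteratedFDeriv k) x

theorem seminorm_le (φ : TestFunction n) (k : ℕ) {C : ℝ}
    (h : ∀ x, ‖iteratedFDeriv ℝ k φ.lift x‖ ≤ C) : seminorm n k φ ≤ C := ciSup_le h

theorem norm_le_seminorm (φ : TestFunction n) (y : Torus n) : ‖φ y‖ ≤ seminorm n 0 φ := by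
  obtain ⟨x, rfl⟩ := proj_surjective y
  simpa [lift] using φ.norm_iteratedFDeriv_le_seminorm 0 x

/-- The seminorms that define the Fréchet topology of `C^∞(T^n)`. -/
def seminormFamily (n : ℕ) : SeminormFamily ℂ (TestFunction n) ℕ := fun k => seminorm n k

instance : TopologicalSpace (TestFunction n) := (seminormFamily n).moduleFilterBasis.topology

theorem withSeminorms (n : ℕ) : WithSeminorms (seminormFamily n) := ⟨rfl⟩

instance : IsTopologicalAddGroup (TestFunction n) := (withSeminorms n).topologicalAddGroup

instance : ContinuousSMul ℂ (TestFunction n) := (withSeminorms n).continuousSMul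

end TestFunction

/-- The space `𝓓'(T^n)` of complex distributions: the topological dual of `C^∞(T^n)`. -/
abbrev Distribution (n : ℕ) : Type := TestFunction n →L[ℂ] ℂ

variable {n : ℕ}

/-- A linear functional bounded by finitely many seminorms is a distribution. -/
def mkDistribution (L : TestFunction n →ₗ[ℂ] ℂ) (C : ℝ≥0) (s : Finset ℕ)
    (h : ∀ φ, ‖L φ‖ ≤ C * ∑ k ∈ s, TestFunction.seminorm n k φ) : Distribution n where
  toLinearMap := L
  cont := by
    have hc : Continuous fun φ : TestFunction n => ∑ k ∈ s, TestFunction.seminorm n k φ :=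
      continuous_finsetSum _ fun k _ => (TestFunction.withSeminorms n).continuous_seminorm k
    refine continuous_of_continuousAt_zero L ?_
    rw [ContinuousAt, map_zero, tendsto_zero_iff_norm_tendsto_zero]
    have h0 : Filter.Tendsto (fun φ : TestFunction n => (C : ℝ) * ∑ k ∈ s,
        TestFunction.seminorm n k φ) (nhds 0) (nhds 0) := by
      simpa using (hc.tendsto 0).const_mul (C : ℝ)
    exact squeeze_zero (fun _ => norm_nonneg _) h h0

theorem integrable_mul_test {g : Torus n → ℂ} (hg : Integrable g) (φ : TestFunction n) :
    Integrable fun x => g x * φ x :=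
  hg.mul_bdd (c := TestFunction.seminorm n 0 φ) φ.continuous.aestronglyMeasurable
    (Filter.Eventually.of_forall φ.norm_le_seminorm)

/-- The regular distribution `φ ↦ ∫ g φ dx` of an integrable function `g`. -/
def ofIntegrable (g : Torus n → ℂ) (hg : Integrable g) : Distribution n :=
  mkDistribution
    { toFun := fun φ => ∫ x, g x * φ x
      map_add' := fun φ ψ => by
        rw [← integral_add (integrable_mul_test hg φ) (integrable_mul_test hg ψ)]
        simp only [TestFunction.add_apply, mul_add]
      map_smul' := fun c φ => by
        rw [RingHom.id_apply, smul_eq_mul, ← integral_const_mul]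
        simp only [TestFunction.smul_apply, mul_left_comm] }
    ⟨∫ x, ‖g x‖, integral_nonneg fun _ => norm_nonneg _⟩ {0} (fun φ => by
      simp only [Finset.sum_singleton, LinearMap.coe_mk, AddHom.coe_mk]
      change _ ≤ (∫ x, ‖g x‖) * _
      rw [← integral_mul_const]
      refine norm_integral_le_of_norm_le (hg.norm.mul_const _)
        (Filter.Eventually.of_forall fun x => ?_)
      rw [norm_mul]
      exact mul_le_mul_of_nonneg_left (φ.norm_le_seminorm x) (norm_nonneg _))

/-- The character `x ↦ e^{i⟨m, x⟩}` of the torus. -/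
def character (m : Fin n → ℤ) : Torus n → ℂ := fun x => ∏ j, fourier (m j) (x j)

theorem character_proj (m : Fin n → ℤ) (x : Fin n → ℝ) :
    character m (proj x) = Complex.exp (Complex.I * ((∑ j, (m j : ℝ) * x j : ℝ) : ℂ)) := by
  simp only [character, proj, fourier_coe_apply]
  rw [← Complex.exp_sum]
  congr 1
  push_cast
  rw [Finset.mul_sum]
  refine Finset.sum_congr rfl fun j _ => ?_
  have : (Real.pi : ℂ) ≠ 0 := by exact_mod_cast Real.pi_ne_zero
  field_simp

theorem character_add (m : Fin n → ℤ) (x y : Torus n) :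
    character m (x + y) = character m x * character m y := by
  obtain ⟨x, rfl⟩ := proj_surjective x
  obtain ⟨y, rfl⟩ := proj_surjective y
  rw [← proj_add, character_proj, character_proj, character_proj, ← Complex.exp_add]
  congr 1
  simp only [Pi.add_apply, mul_add, Finset.sum_add_distrib]
  push_cast
  ring

theorem norm_character (m : Fin n → ℤ) (x : Torus n) : ‖character m x‖ = 1 := by
  obtain ⟨x, rfl⟩ := proj_surjective x
  rw [character_proj, mul_comm, Complex.norm_exp_ofReal_mul_I]

theorem contDiff_character (m : Fin n → ℤ) :
    ContDiff ℝ ∞ (fun x : Fin n → ℝ => character m (proj x)) := by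
  simp only [character_proj]
  have h0 : ContDiff ℝ ∞ fun x : Fin n → ℝ => ∑ j, (m j : ℝ) * x j :=
    ContDiff.sum fun j _ => contDiff_const.mul (contDiff_apply ℝ ℝ j)
  exact (contDiff_const.mul (Complex.ofRealCLM.contDiff.comp h0)).cexp

/-- The character `x ↦ e^{i⟨m, x⟩}` as a test function. -/
def charTest (m : Fin n → ℤ) : TestFunction n := ⟨character m, contDiff_character m⟩

/-- The Fourier coefficient `û(m) = (2π)^{-n} ⟨u, e^{-i⟨m, ·⟩}⟩`. -/
def fourierCoeff (u : Distribution n) (m : Fin n → ℤ) : ℂ :=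
  ((2 * Real.pi : ℂ) ^ n)⁻¹ * u (charTest (-m))

theorem exists_bound (u : Distribution n) : ∃ C : ℝ, ∃ s : Finset ℕ, 0 ≤ C ∧
    ∀ φ, ‖u φ‖ ≤ C * ∑ k ∈ s, TestFunction.seminorm n k φ := by
  obtain ⟨s, C, -, h⟩ := Seminorm.bound_of_continuous (TestFunction.withSeminorms n)
    ((normSeminorm ℂ ℂ).comp u.toLinearMap) (by
      change Continuous fun φ => ‖u φ‖
      exact u.continuous.norm)
  refine ⟨C, s, C.2, fun φ => (h φ).trans ?_⟩
  have := Seminorm.finset_sup_le_sum (TestFunction.seminormFamily n) s φ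
  rw [_root_.smul_apply, NNReal.smul_def, smul_eq_mul]
  refine mul_le_mul_of_nonneg_left (this.trans (le_of_eq ?_)) C.2
  simp [TestFunction.seminormFamily]

/-- Polynomial growth of a family of coefficients on `ℤ^n`. -/
def PolyGrowth (c : (Fin n → ℤ) → ℂ) : Prop :=
  ∃ C : ℝ, ∃ N : ℕ, 0 ≤ C ∧ ∀ m, ‖c m‖ ≤ C * (1 + ‖m‖) ^ N

theorem PolyGrowth.mul {c d : (Fin n → ℤ) → ℂ} (hc : PolyGrowth c) (hd : PolyGrowth d) :
    PolyGrowth fun m => c m * d m := by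
  obtain ⟨C, N, hC, h⟩ := hc
  obtain ⟨D, M, hD, h'⟩ := hd
  refine ⟨C * D, N + M, mul_nonneg hC hD, fun m => ?_⟩
  rw [norm_mul]
  calc ‖c m‖ * ‖d m‖ ≤ (C * (1 + ‖m‖) ^ N) * (D * (1 + ‖m‖) ^ M) :=
        mul_le_mul (h m) (h' m) (norm_nonneg _) (by positivity)
    _ = C * D * (1 + ‖m‖) ^ (N + M) := by ring

theorem seminorm_charTest_le (m : Fin n → ℤ) (k : ℕ) :
    TestFunction.seminorm n k (charTest m) ≤ (n * ‖m‖) ^ k := by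
  refine TestFunction.seminorm_le _ _ fun x => ?_
  let L : (Fin n → ℝ) →L[ℝ] ℝ := ∑ j, (m j : ℝ) • ContinuousLinearMap.proj (R := ℝ) (φ := fun _ : Fin n => ℝ) j
  have hL : ‖L‖ ≤ n * ‖m‖ := by
    refine L.opNorm_le_bound (by positivity) fun y => ?_
    have : L y = ∑ j, (m j : ℝ) * y j := by simp [L]
    rw [this]
    calc ‖∑ j, (m j : ℝ) * y j‖ ≤ ∑ j : Fin n, ‖m‖ * ‖y‖ := norm_sum_le_of_le _ fun j _ => by
          rw [norm_mul]
          refine mul_le_mul ?_ (norm_le_pi_norm y j) (norm_nonneg _) (norm_nonneg _)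
          rw [Int.norm_cast_real]
          exact norm_le_pi_norm m j
      _ = n * ‖m‖ * ‖y‖ := by simp [mul_assoc]
  let E : ℝ → ℂ := fun t => Complex.exp (Complex.I * (t : ℂ))
  have hE : ContDiff ℝ ∞ E := (contDiff_const.mul Complex.ofRealCLM.contDiff).cexp
  have hlift : (charTest m).lift = E ∘ L := by
    funext y
    change character m (proj y) = E (L y)
    rw [character_proj]
    simp [E, L]
  have hd : ∀ i : ℕ, iteratedDeriv i E = fun t => Complex.I ^ i * E t := by
    intro i
    induction i with
    | zero => simp
    | succ i ih =>
      rw [iteratedDeriv_succ, ih]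
      funext t
      have h1 : HasDerivAt E (Complex.exp (Complex.I * (t : ℂ)) * (Complex.I * 1)) t :=
        ((Complex.ofRealCLM.hasDerivAt (x := t)).const_mul Complex.I).cexp
      rw [(h1.const_mul (Complex.I ^ i)).deriv]
      simp only [E]
      ring
  rw [hlift, ContinuousLinearMap.iteratedFDeriv_comp_right L hE x (by exact_mod_cast le_top)]
  refine (ContinuousMultilinearMap.norm_compContinuousLinearMap_le _ _).trans ?_
  rw [norm_iteratedFDeriv_eq_norm_iteratedDeriv, hd]
  have : ‖E (L x)‖ = 1 := by
    simp only [E]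
    rw [mul_comm, Complex.norm_exp_ofReal_mul_I]
  simp only [norm_mul, norm_pow, Complex.norm_I, one_pow, this, one_mul, Finset.prod_const,
    Finset.card_univ, Fintype.card_fin]
  exact pow_le_pow_left₀ (norm_nonneg _) hL k

/-- The Fourier coefficients of a distribution grow at most polynomially. -/
theorem polyGrowth_fourierCoeff (u : Distribution n) : PolyGrowth (fourierCoeff u) := by
  obtain ⟨C, s, hC, h⟩ := exists_bound u
  refine ⟨‖((2 * Real.pi : ℂ) ^ n)⁻¹‖ * (C * (s.card * (1 + n) ^ s.sup id)), s.sup id,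
    by positivity, fun m => ?_⟩
  rw [fourierCoeff, norm_mul, mul_assoc, mul_assoc]
  refine mul_le_mul_of_nonneg_left ((h _).trans ?_) (norm_nonneg _)
  refine mul_le_mul_of_nonneg_left ?_ hC
  calc ∑ k ∈ s, TestFunction.seminorm n k (charTest (-m))
      ≤ ∑ k ∈ s, ((1 + n : ℝ) * (1 + ‖m‖)) ^ s.sup id := Finset.sum_le_sum fun k hk => by
        refine (seminorm_charTest_le _ _).trans ?_
        rw [norm_neg]
        have h0 : (n : ℝ) * ‖m‖ ≤ (1 + n) * (1 + ‖m‖) := by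
          nlinarith [norm_nonneg m, (Nat.cast_nonneg n : (0 : ℝ) ≤ n)]
        have h1 : (1 : ℝ) ≤ (1 + n) * (1 + ‖m‖) := by
          nlinarith [norm_nonneg m, (Nat.cast_nonneg n : (0 : ℝ) ≤ n),
            mul_nonneg (Nat.cast_nonneg n : (0 : ℝ) ≤ n) (norm_nonneg m)]
        exact (pow_le_pow_left₀ (by positivity) h0 k).trans
          (pow_le_pow_right₀ h1 (Finset.le_sup (f := id) hk))
    _ = s.card * (1 + n) ^ s.sup id * (1 + ‖m‖) ^ s.sup id := by
        rw [Finset.sum_const, nsmul_eq_mul, mul_pow, mul_assoc]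

/-- `∫ φ e^{i⟨m, x⟩} dx`. -/
def pairing (m : Fin n → ℤ) (φ : TestFunction n) : ℂ := ∫ x, character m x * φ x

theorem integrable_character (m : Fin n → ℤ) : Integrable (character m) :=
  (charTest m).continuous.integrable_of_hasCompactSupport (HasCompactSupport.of_compactSpace _)

/-- The partial derivative `∂_j φ`. -/
def pderiv (j : Fin n) (φ : TestFunction n) : TestFunction n :=
  ⟨fun x => deriv (fun t : ℝ => φ (x + proj (Pi.single j t))) 0, by
    have h : (fun x : Fin n → ℝ => deriv (fun t : ℝ => φ (proj x + proj (Pi.single j t))) 0) =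
        fun x => fderiv ℝ φ.lift x (Pi.single j 1) := by
      funext x
      have h1 : HasFDerivAt φ.lift (fderiv ℝ φ.lift x) (x + Pi.single j (0 : ℝ)) := by
        rw [Pi.single_zero, add_zero]
        exact (φ.contDiff_lift.differentiable (by simp) x).hasFDerivAt
      have h2 : HasDerivAt (fun t : ℝ => x + Pi.single j t) (Pi.single j (1 : ℝ)) 0 :=
        (hasDerivAt_single j (0 : ℝ)).const_add x
      exact (h1.comp_hasDerivAt (0 : ℝ) h2).deriv
    change ContDiff ℝ ∞ (fun x : Fin n → ℝ =>
      deriv (fun t : ℝ => φ (proj x + proj (Pi.single j t))) 0)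
    rw [h]
    exact (φ.contDiff_lift.fderiv_right (m := ∞) (by simp)).clm_apply contDiff_const⟩

theorem hasDerivAt_translate (j : Fin n) (φ : TestFunction n) (x : Torus n) (t : ℝ) :
    HasDerivAt (fun t : ℝ => φ (x + proj (Pi.single j t)))
      (pderiv j φ (x + proj (Pi.single j t))) t := by
  obtain ⟨x, rfl⟩ := proj_surjective x
  have key : ∀ (y : Fin n → ℝ) (t : ℝ), HasDerivAt (fun t : ℝ => φ.lift (y + Pi.single j t))
      (fderiv ℝ φ.lift (y + Pi.single j t) (Pi.single j 1)) t := fun y t =>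
    ((φ.contDiff_lift.differentiable (by simp) _).hasFDerivAt).comp_hasDerivAt t
      ((hasDerivAt_single j t).const_add y)
  have h2 : pderiv j φ (proj x + proj (Pi.single j t)) =
      fderiv ℝ φ.lift (x + Pi.single j t) (Pi.single j 1) := by
    have := (key (x + Pi.single j t) 0).deriv
    rw [Pi.single_zero, add_zero] at this
    exact this
  rw [h2]
  exact key x t

theorem lift_pderiv (j : Fin n) (φ : TestFunction n) :
    (pderiv j φ).lift = fun x => fderiv ℝ φ.lift x (Pi.single j 1) := by
  funext x
  have h := (hasDerivAt_translate j φ (proj x) 0)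
  have h1 : HasDerivAt (fun t : ℝ => φ.lift (x + Pi.single j t))
      (fderiv ℝ φ.lift (x + Pi.single j 0) (Pi.single j 1)) 0 :=
    ((φ.contDiff_lift.differentiable (by simp) _).hasFDerivAt).comp_hasDerivAt 0
      ((hasDerivAt_single j 0).const_add x)
  have h2 := h.unique h1
  rw [← proj_add, Pi.single_zero, add_zero] at h2
  exact h2

theorem seminorm_pderiv_le (j : Fin n) (φ : TestFunction n) (k : ℕ) :
    TestFunction.seminorm n k (pderiv j φ) ≤ TestFunction.seminorm n (k + 1) φ := by
  refine TestFunction.seminorm_le _ _ fun x => ?_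
  rw [lift_pderiv]
  have h := ContinuousLinearMap.norm_iteratedFDeriv_comp_left
    (ContinuousLinearMap.apply ℝ ℂ (Pi.single j (1 : ℝ) : Fin n → ℝ))
    (f := fderiv ℝ φ.lift) (x := x) (N := ∞) (n := k)
    (φ.contDiff_lift.fderiv_right (m := ∞) (by simp)).contDiffAt (by exact_mod_cast le_top)
  have hn : ‖ContinuousLinearMap.apply ℝ ℂ (Pi.single j (1 : ℝ) : Fin n → ℝ)‖ ≤ 1 := by
    refine ContinuousLinearMap.opNorm_le_bound _ zero_le_one fun A => ?_
    have := A.le_opNorm (Pi.single j (1 : ℝ))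
    simpa [Pi.norm_single] using this
  refine h.trans ?_
  rw [norm_iteratedFDeriv_fderiv]
  calc _ ≤ 1 * ‖iteratedFDeriv ℝ (k + 1) φ.lift x‖ :=
        mul_le_mul_of_nonneg_right hn (norm_nonneg _)
    _ ≤ _ := by rw [one_mul]; exact φ.norm_iteratedFDeriv_le_seminorm _ _

/-- Integration by parts. -/
theorem pairing_pderiv (m : Fin n → ℤ) (j : Fin n) (φ : TestFunction n) :
    pairing m (pderiv j φ) = -(Complex.I * m j) * pairing m φ := by
  have h1 : HasDerivAt (fun t : ℝ => ∫ x, character m x * φ (x + proj (Pi.single j t)))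
      (∫ x, character m x * pderiv j φ (x + proj (Pi.single j (0 : ℝ)))) 0 := by
    refine (hasDerivAt_integral_of_dominated_loc_of_deriv_le (μ := volume)
      (F := fun t x => character m x * φ (x + proj (Pi.single j t)))
      (F' := fun t x => character m x * pderiv j φ (x + proj (Pi.single j t)))
      (bound := fun _ => TestFunction.seminorm n 0 (pderiv j φ)) (s := Set.univ)
      Filter.univ_mem ?_ ?_ ?_ ?_ ?_ ?_).2
    · exact Filter.Eventually.of_forall fun t => ((charTest m).continuous.mul
        (φ.continuous.comp (continuous_id.add continuous_const))).aestronglyMeasurable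
    · have := integrable_mul_test (integrable_character m) φ
      simpa [proj_zero] using this
    · exact ((charTest m).continuous.mul
        ((pderiv j φ).continuous.comp (continuous_id.add continuous_const))).aestronglyMeasurable
    · refine Filter.Eventually.of_forall fun x t _ => ?_
      rw [norm_mul, norm_character, one_mul]
      exact (pderiv j φ).norm_le_seminorm _
    · exact integrable_const _
    · exact Filter.Eventually.of_forall fun x t _ => (hasDerivAt_translate j φ x t).const_mul _
  have h2 : ∀ t : ℝ, ∫ x, character m x * φ (x + proj (Pi.single j t)) =
      Complex.exp (-(Complex.I * m j) * t) * pairing m φ := by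
    intro t
    have := integral_add_right_eq_self (μ := (volume : Measure (Torus n)))
      (fun x => character m (x - proj (Pi.single j t)) * φ x) (proj (Pi.single j t))
    simp only [add_sub_cancel_right] at this
    rw [this, pairing, ← integral_const_mul]
    refine integral_congr_ae (Filter.Eventually.of_forall fun x => ?_)
    have hneg : -proj (Pi.single j t) = (proj (-Pi.single j t) : Torus n) := rfl
    simp only
    rw [sub_eq_add_neg, character_add, hneg, character_proj]
    have hs : ∑ i, (m i : ℝ) * (-Pi.single j t : Fin n → ℝ) i = -(m j * t) := by
      simp [Pi.single_apply]
    rw [hs, mul_comm (character m x), mul_assoc]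
    congr 2
    push_cast
    ring
  have h3 : HasDerivAt (fun t : ℝ => Complex.exp (-(Complex.I * m j) * t) * pairing m φ)
      (Complex.exp (-(Complex.I * m j) * (0 : ℝ)) * (-(Complex.I * m j) * 1) * pairing m φ) 0 :=
    (((Complex.ofRealCLM.hasDerivAt (x := 0)).const_mul _).cexp).mul_const _
  rw [show (fun t : ℝ => ∫ x, character m x * φ (x + proj (Pi.single j t))) =
    fun t : ℝ => Complex.exp (-(Complex.I * m j) * t) * pairing m φ from funext h2] at h1
  have h4 := h1.unique h3
  simpa [proj_zero, pairing] using h4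

theorem norm_pairing_le (m : Fin n → ℤ) (φ : TestFunction n) :
    ‖pairing m φ‖ ≤ (2 * Real.pi) ^ n * TestFunction.seminorm n 0 φ := by
  have h : ‖pairing m φ‖ ≤ TestFunction.seminorm n 0 φ * (volume : Measure (Torus n)).real Set.univ := by
    refine norm_integral_le_of_norm_le_const (Filter.Eventually.of_forall fun x => ?_)
    rw [norm_mul, norm_character, one_mul]
    exact φ.norm_le_seminorm x
  have hv : (volume : Measure (Torus n)).real Set.univ = (2 * Real.pi) ^ n := by
    rw [Measure.real, volume_pi, Measure.pi_univ]
    simp [AddCircle.measure_univ, Real.pi_pos.le]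
  rw [hv, mul_comm] at h
  exact h

theorem pow_mul_norm_pairing_le (m : Fin n → ℤ) (k : ℕ) (φ : TestFunction n) :
    ‖m‖ ^ k * ‖pairing m φ‖ ≤ (2 * Real.pi) ^ n * TestFunction.seminorm n k φ := by
  induction k generalizing φ with
  | zero => simpa using norm_pairing_le m φ
  | succ k ih =>
    by_cases hm : m = 0
    · subst hm
      rw [norm_zero, zero_pow (Nat.succ_ne_zero k), zero_mul]
      exact mul_nonneg (by positivity) (apply_nonneg _ _)
    have : Nonempty (Fin n) := by
      by_contra hne
      rw [not_nonempty_iff] at hne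
      exact hm (Subsingleton.elim _ _)
    obtain ⟨j, hj⟩ : ∃ j, ‖m‖ = ‖m j‖ := by
      obtain ⟨j, hj⟩ := Finite.exists_max fun j => ‖m j‖
      exact ⟨j, le_antisymm ((pi_norm_le_iff_of_nonneg (norm_nonneg _)).2 hj) (norm_le_pi_norm m j)⟩
    have h := ih (pderiv j φ)
    rw [pairing_pderiv, norm_mul, norm_neg, norm_mul, Complex.norm_I, one_mul,
      Complex.norm_intCast, ← Int.norm_eq_abs, ← hj, ← mul_assoc, ← pow_succ] at h
    exact h.trans (mul_le_mul_of_nonneg_left (seminorm_pderiv_le j φ k) (by positivity))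

theorem summable_weight (n : ℕ) : Summable fun m : Fin n → ℤ => ((1 + ‖m‖) ^ (n + 1))⁻¹ := by
  let b := Pi.basisFun ℝ (Fin n)
  let L : Submodule ℤ (Fin n → ℝ) := Submodule.span ℤ (Set.range b)
  have hL : Summable fun z : L => ‖z‖⁻¹ ^ (n + 1) := by
    refine ZLattice.summable_norm_pow_inv L (n + 1) ?_
    rw [ZLattice.rank ℝ L]
    simp
  let ι : (Fin n → ℤ) → L := fun m => ⟨fun j => (m j : ℝ), by
    rw [Module.Basis.mem_span_iff_repr_mem]
    intro i
    exact ⟨m i, by simp [b]⟩⟩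
  have hι : Function.Injective ι := by
    intro m m' h
    funext j
    have : (m j : ℝ) = m' j := congrFun (congrArg Subtype.val h) j
    exact_mod_cast this
  have hn : ∀ m, ‖ι m‖ = ‖m‖ := by
    intro m
    change ‖fun j => (m j : ℝ)‖ = ‖m‖
    have : ∀ j, ‖(m j : ℝ)‖₊ = ‖m j‖₊ := fun j => NNReal.eq (Int.norm_cast_real (m j))
    simp only [Pi.norm_def, this]
  have h2 := hL.comp_injective hι
  refine Summable.of_norm_bounded_eventually h2 ?_
  filter_upwards [(Set.finite_singleton (0 : Fin n → ℤ)).compl_mem_cofinite] with m hm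
  have hm0 : 0 < ‖m‖ := norm_pos_iff.2 hm
  rw [Real.norm_of_nonneg (by positivity)]
  simp only [Function.comp, hn, inv_pow]
  gcongr
  linarith

/-- The bound behind the convergence of `∑ c_m ∫ φ e^{i⟨m, x⟩}`. -/
theorem norm_coeff_mul_pairing_le {c : (Fin n → ℤ) → ℂ} {C : ℝ} {N : ℕ} (hC : 0 ≤ C)
    (h : ∀ m, ‖c m‖ ≤ C * (1 + ‖m‖) ^ N) (m : Fin n → ℤ) (φ : TestFunction n) :
    ‖c m * pairing m φ‖ ≤ C * 2 ^ (N + (n + 1)) * (2 * Real.pi) ^ n *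
      ((1 + ‖m‖) ^ (n + 1))⁻¹ *
      (TestFunction.seminorm n 0 φ + TestFunction.seminorm n (N + (n + 1)) φ) := by
  set M := N + (n + 1) with hM
  have h1 : (1 + ‖m‖) ^ M * ‖pairing m φ‖ ≤ 2 ^ M * ((2 * Real.pi) ^ n *
      (TestFunction.seminorm n 0 φ + TestFunction.seminorm n M φ)) := by
    have hp : (1 + ‖m‖) ^ M ≤ 2 ^ M * (1 + ‖m‖ ^ M) := by
      refine (add_pow_le zero_le_one (norm_nonneg m) M).trans ?_
      rw [one_pow]
      gcongr
      · norm_num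
      · omega
    calc (1 + ‖m‖) ^ M * ‖pairing m φ‖ ≤ 2 ^ M * (1 + ‖m‖ ^ M) * ‖pairing m φ‖ := by gcongr
      _ = 2 ^ M * (‖m‖ ^ 0 * ‖pairing m φ‖ + ‖m‖ ^ M * ‖pairing m φ‖) := by ring
      _ ≤ 2 ^ M * ((2 * Real.pi) ^ n * TestFunction.seminorm n 0 φ +
          (2 * Real.pi) ^ n * TestFunction.seminorm n M φ) := by
        exact mul_le_mul_of_nonneg_left (add_le_add (pow_mul_norm_pairing_le m 0 φ)
          (pow_mul_norm_pairing_le m M φ)) (by positivity)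
      _ = _ := by ring
  have hpos : 0 < (1 + ‖m‖) ^ (n + 1) := by positivity
  calc ‖c m * pairing m φ‖ ≤ C * (1 + ‖m‖) ^ N * ‖pairing m φ‖ := by
        rw [norm_mul]; exact mul_le_mul_of_nonneg_right (h m) (norm_nonneg _)
    _ = C * ((1 + ‖m‖) ^ (n + 1))⁻¹ * ((1 + ‖m‖) ^ M * ‖pairing m φ‖) := by
        rw [hM, pow_add (1 + ‖m‖) N (n + 1)]; field_simp
    _ ≤ C * ((1 + ‖m‖) ^ (n + 1))⁻¹ * (2 ^ M * ((2 * Real.pi) ^ n *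
      (TestFunction.seminorm n 0 φ + TestFunction.seminorm n M φ))) := by gcongr
    _ = _ := by ring

theorem summable_coeff_mul_pairing {c : (Fin n → ℤ) → ℂ} (hc : PolyGrowth c)
    (φ : TestFunction n) : Summable fun m => c m * pairing m φ := by
  obtain ⟨C, N, hC, h⟩ := hc
  exact Summable.of_norm_bounded (((summable_weight n).mul_left _).mul_right _)
    fun m => norm_coeff_mul_pairing_le hC h m φ

theorem pairing_add (m : Fin n → ℤ) (φ ψ : TestFunction n) :
    pairing m (φ + ψ) = pairing m φ + pairing m ψ :=
  (ofIntegrable (character m) (integrable_character m)).map_add φ ψ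

theorem pairing_smul (m : Fin n → ℤ) (c : ℂ) (φ : TestFunction n) :
    pairing m (c • φ) = c * pairing m φ :=
  (ofIntegrable (character m) (integrable_character m)).map_smul c φ

/-- The distribution `∑_m c_m e^{i⟨m, x⟩}`, for coefficients of polynomial growth. -/
def ofCoeffs (c : (Fin n → ℤ) → ℂ) (hc : PolyGrowth c) : Distribution n :=
  mkDistribution
    { toFun := fun φ => ∑' m, c m * pairing m φ
      map_add' := fun φ ψ => by
        rw [← (summable_coeff_mul_pairing hc φ).tsum_add (summable_coeff_mul_pairing hc ψ)]
        simp only [pairing_add, mul_add]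
      map_smul' := fun a φ => by
        rw [RingHom.id_apply, smul_eq_mul, ← tsum_mul_left]
        simp only [pairing_smul, mul_left_comm] }
    (Real.toNNReal (hc.choose * 2 ^ (hc.choose_spec.choose + (n + 1)) * (2 * Real.pi) ^ n *
      ∑' m : Fin n → ℤ, ((1 + ‖m‖) ^ (n + 1))⁻¹)) {0, hc.choose_spec.choose + (n + 1)} (fun φ => by
      obtain ⟨hC, h⟩ := hc.choose_spec.choose_spec
      set C := hc.choose
      set N := hc.choose_spec.choose
      rw [Finset.sum_pair (by omega), Real.coe_toNNReal _ (by positivity)]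
      refine (tsum_of_norm_bounded (((summable_weight n).mul_left _).mul_right _).hasSum
        fun m => norm_coeff_mul_pairing_le hC h m φ).trans (le_of_eq ?_)
      rw [tsum_mul_right, tsum_mul_left])

theorem ofCoeffs_apply (c : (Fin n → ℤ) → ℂ) (hc : PolyGrowth c) (φ : TestFunction n) :
    ofCoeffs c hc φ = ∑' m, c m * pairing m φ := rfl

theorem pairing_charTest_neg (m k : Fin n → ℤ) :
    pairing m (charTest (-k)) = if m = k then (2 * Real.pi : ℂ) ^ n else 0 := by
  have hmul : ∀ x : Torus n, character m x * charTest (-k) x = character (m - k) x := by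
    intro x
    obtain ⟨x, rfl⟩ := proj_surjective x
    change character m (proj x) * character (-k) (proj x) = _
    rw [character_proj, character_proj, character_proj, ← Complex.exp_add]
    congr 1
    simp only [Pi.neg_apply, Pi.sub_apply]
    push_cast
    simp only [sub_mul, neg_mul, Finset.sum_sub_distrib, Finset.sum_neg_distrib]
    ring
  have h1 : pairing m (charTest (-k)) = ∫ x : Torus n, ∏ j, fourier (T := 2 * Real.pi) ((m - k) j) (x j) :=
    integral_congr_ae (Filter.Eventually.of_forall hmul)
  have h2 : ∀ p : ℤ, ∫ y : AddCircle (2 * Real.pi), fourier p y =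
      if p = 0 then (2 * Real.pi : ℂ) else 0 := by
    intro p
    split_ifs with hp
    · subst hp
      simp [Measure.real, AddCircle.measure_univ, Real.pi_pos.le]
    · exact integral_eq_zero_of_add_right_eq_neg (μ := volume) (fourier_add_half_inv_index hp Real.two_pi_pos)
  rw [h1, volume_pi, integral_fintype_prod_eq_prod]
  simp only [h2, Pi.sub_apply]
  split_ifs with hmk
  · subst hmk
    simp
  · obtain ⟨j, hj⟩ := Function.ne_iff.1 hmk
    exact Finset.prod_eq_zero (Finset.mem_univ j) (if_neg (sub_ne_zero.2 hj))

theorem fourierCoeff_ofCoeffs (c : (Fin n → ℤ) → ℂ) (hc : PolyGrowth c) (m : Fin n → ℤ) :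
    fourierCoeff (ofCoeffs c hc) m = c m := by
  have h0 : ((2 * Real.pi : ℂ) ^ n) ≠ 0 :=
    pow_ne_zero _ (by exact_mod_cast Real.two_pi_pos.ne')
  rw [fourierCoeff, ofCoeffs_apply, tsum_eq_single m (fun k hk => by
    rw [pairing_charTest_neg, if_neg hk, mul_zero]), pairing_charTest_neg, if_pos rfl]
  field_simp

/-- The Fourier multiplier with symbol `σ`: the distribution whose Fourier coefficients are
`σ(m) û(m)`. -/
def multiplier (σ : (Fin n → ℤ) → ℂ) (hσ : PolyGrowth σ) (u : Distribution n) : Distribution n :=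
  ofCoeffs (fun m => σ m * fourierCoeff u m) (hσ.mul (polyGrowth_fourierCoeff u))

theorem fourierCoeff_multiplier (σ : (Fin n → ℤ) → ℂ) (hσ : PolyGrowth σ) (u : Distribution n)
    (m : Fin n → ℤ) : fourierCoeff (multiplier σ hσ u) m = σ m * fourierCoeff u m :=
  fourierCoeff_ofCoeffs _ _ m

/-- The Euclidean length of a lattice point. -/
def latticeNorm (m : Fin n → ℤ) : ℝ := Real.sqrt (∑ j, (m j : ℝ) ^ 2)

theorem abs_le_latticeNorm (m : Fin n → ℤ) (j : Fin n) : |(m j : ℝ)| ≤ latticeNorm m :=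
  Real.abs_le_sqrt (Finset.single_le_sum (f := fun j => (m j : ℝ) ^ 2)
    (fun _ _ => sq_nonneg _) (Finset.mem_univ j))

theorem latticeNorm_le (m : Fin n → ℤ) : latticeNorm m ≤ (1 + n) * (1 + ‖m‖) := by
  refine Real.sqrt_le_iff.2 ⟨by positivity, ?_⟩
  calc ∑ j, (m j : ℝ) ^ 2 ≤ ∑ _j : Fin n, ‖m‖ ^ 2 := Finset.sum_le_sum fun j _ => by
        have := norm_le_pi_norm m j
        rw [Int.norm_eq_abs] at this
        rw [← sq_abs]
        gcongr
    _ = n * ‖m‖ ^ 2 := by simp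
    _ ≤ ((1 + n) * (1 + ‖m‖)) ^ 2 := by
      have h1 : (n : ℝ) ≤ (1 + n) ^ 2 := by nlinarith [(Nat.cast_nonneg n : (0 : ℝ) ≤ n)]
      have h2 : ‖m‖ ^ 2 ≤ (1 + ‖m‖) ^ 2 := by nlinarith [norm_nonneg m]
      rw [mul_pow]
      gcongr

theorem polyGrowth_fracLaplacian (s : ℝ≥0) :
    PolyGrowth fun m : Fin n → ℤ => ((latticeNorm m ^ (2 * (s : ℝ)) : ℝ) : ℂ) := by
  refine ⟨(1 + n) ^ ⌈2 * (s : ℝ)⌉₊, ⌈2 * (s : ℝ)⌉₊, by positivity, fun m => ?_⟩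
  have h0 : 0 ≤ latticeNorm m := Real.sqrt_nonneg _
  rw [Complex.norm_real, Real.norm_of_nonneg (Real.rpow_nonneg h0 _), ← mul_pow]
  have h1 : (1 : ℝ) ≤ (1 + n) * (1 + ‖m‖) := by
    nlinarith [norm_nonneg m, (Nat.cast_nonneg n : (0 : ℝ) ≤ n),
      mul_nonneg (Nat.cast_nonneg n : (0 : ℝ) ≤ n) (norm_nonneg m)]
  calc latticeNorm m ^ (2 * (s : ℝ)) ≤ ((1 + n) * (1 + ‖m‖)) ^ (2 * (s : ℝ)) :=
        Real.rpow_le_rpow h0 (latticeNorm_le m) (by positivity)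
    _ ≤ ((1 + n) * (1 + ‖m‖)) ^ ((⌈2 * (s : ℝ)⌉₊ : ℕ) : ℝ) :=
        Real.rpow_le_rpow_of_exponent_le h1 (Nat.le_ceil _)
    _ = _ := Real.rpow_natCast _ _

theorem polyGrowth_riesz (j : Fin n) :
    PolyGrowth fun m : Fin n → ℤ => Complex.I * (((m j : ℝ) / latticeNorm m : ℝ) : ℂ) := by
  refine ⟨1, 0, zero_le_one, fun m => ?_⟩
  have h0 : 0 ≤ latticeNorm m := Real.sqrt_nonneg _
  rw [norm_mul, Complex.norm_I, Complex.norm_real, Real.norm_eq_abs, abs_div,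
    abs_of_nonneg h0, pow_zero, one_mul, one_mul]
  exact div_le_one_of_le₀ (abs_le_latticeNorm m j) (Real.sqrt_nonneg _)

/-- The fractional Laplacian `(-Δ)^s`, with symbol `|m|^{2s}`. -/
def fracLaplacian (s : ℝ≥0) (u : Distribution n) : Distribution n :=
  multiplier (fun m => ((latticeNorm m ^ (2 * (s : ℝ)) : ℝ) : ℂ)) (polyGrowth_fracLaplacian s) u

/-- The Riesz transform `𝓡_j`, with symbol `i m_j / |m|` (and `0` at `m = 0`). -/
def riesz (j : Fin n) (u : Distribution n) : Distribution n :=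
  multiplier (fun m => Complex.I * (((m j : ℝ) / latticeNorm m : ℝ) : ℂ)) (polyGrowth_riesz j) u

/-- The norm of the homogeneous Sobolev space `Ḣ^s(T^n)`, that is
`(∑_m |m|^{2s} |v̂(m)|²)^{1/2}` in `[0, ∞]`. For `s < 0` the factor `|0|^{2s}` is `∞`, with
`∞ · 0 = 0`: a distribution of finite norm then has `v̂(0) = 0`. -/
def sobolevNorm (s : ℝ) (v : Distribution n) : ℝ≥0∞ :=
  (∑' m : Fin n → ℤ, ENNReal.ofReal (latticeNorm m) ^ (2 * s) * ‖fourierCoeff v m‖ₑ ^ 2) ^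
    (1 / 2 : ℝ)

/-- Membership in `L¹(T^n) + Ḣ^s(T^n)`. -/
def MemSum (s : ℝ) (v : Distribution n) : Prop :=
  ∃ (g : Torus n → ℂ) (hg : Integrable g) (h : Distribution n),
    sobolevNorm s h < ⊤ ∧ v = ofIntegrable g hg + h

/-- The norm of `L¹(T^n) + Ḣ^s(T^n)`: the infimum of `‖g‖_{L¹} + ‖h‖_{Ḣ^s}` over all
decompositions `v = g + h`. -/
def sumNorm (s : ℝ) (v : Distribution n) : ℝ≥0∞ :=
  ⨅ (g : Torus n → ℂ) (hg : Integrable g) (h : Distribution n)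
    (_ : v = ofIntegrable g hg + h), eLpNorm g 1 volume + sobolevNorm s h

/-- The mean value of a distribution, `(2π)^{-n} ⟨u, 1⟩`, as a constant distribution. -/
def mean (u : Distribution n) : Distribution n :=
  ofIntegrable (fun _ => ((2 * Real.pi : ℂ) ^ n)⁻¹ * u (charTest 0)) (integrable_const _)

end

end TorusDist

/-! Write `v` for the image of `u` under the fractional Laplacian of order `n/4`. For `m ≠ 0` one
has `|û(m)|² = |m|^{-n} |v̂(m)|²`, so the task is to bound `∑_{m ≠ 0} |m|^{-n} |v̂(m)|²` by the
square of the right-hand side. Fix decompositions `v = g₀ + h₀` and `R_j v = g_j + h_j`.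

The Riesz transforms enter through `|m| v̂(m) = -i ∑_j m_j (R_j v)^(m)`. For a weight `w(m)` of size
`|m|^{-n-1}` this turns `∑ w |m| |v̂|²` into `-i ∑_j ∑_m w(m) m_j (R_j v)^(m) conj v̂(m)`. The
symbol `w(m) m_j` is odd and of order `-n`; the oddness removes the logarithmic singularity of a
general symbol of that order, so its kernel is bounded. The part of the sum pairing `g_j` with `g₀`
is therefore a double integral against a bounded kernel, at most a constant times `‖g_j‖₁ ‖g₀‖₁`.
Every remaining product contains a coefficient of `h₀` or `h_j`, and Young's inequality bounds these
by half of the left side plus Sobolev norms.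

The weight is `dyadicWeight K`, a finite sum of tensor products of Fejér weights over the scales
`2^k`. It has finite support, so the quantity absorbed is finite, and all constants are independent
of `K`. Its kernel is a product of one-dimensional sums controlled by geometric series
(`norm_sum_dyadicWeight_mul_character_le`); its size is given by `dyadicWeight_le` and
`le_dyadicWeight`. The a priori estimate is `exists_sum_inv_latticeNorm_pow_mul_le`. The function
itself then comes from Riesz–Fischer (`exists_memLp_fourierCoeff_eq`) and is identified with `u`
minus its mean because Fourier coefficients determine a distribution (`ext_fourierCoeff`). -/

namespace TorusDist

/-! ### Fejér weights -/

/-- The number of pairs in `{0, …, N - 1}²` with difference `m`. -/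
def fejerCount (N : ℕ) (m : ℤ) : ℕ :=
  ((Finset.range N ×ˢ Finset.range N).filter fun p : ℕ × ℕ => (p.1 : ℤ) - p.2 = m).card

theorem fejerCount_le (N : ℕ) (m : ℤ) : fejerCount N m ≤ N := by
  refine (Finset.card_le_card_of_injOn (t := Finset.range N) Prod.fst ?_ ?_).trans
    (Finset.card_range N).le
  · intro p hp
    simp only [Finset.coe_filter, Finset.mem_product, Set.mem_ofPred_eq] at hp
    exact hp.1.1
  · rintro ⟨a, b⟩ hp ⟨c, d⟩ hq h
    simp only [Finset.coe_filter, Finset.mem_product, Set.mem_ofPred_eq] at hp hq h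
    ext
    · exact h
    · simp only
      omega

theorem fejerCount_eq_zero {N : ℕ} {m : ℤ} (h : (N : ℤ) ≤ |m|) : fejerCount N m = 0 := by
  rw [fejerCount, Finset.card_eq_zero, Finset.filter_eq_empty_iff]
  rintro ⟨a, b⟩ hp
  simp only [Finset.mem_product, Finset.mem_range] at hp
  simp only
  intro h'
  rcases abs_cases m with h1 | h1 <;> omega

theorem sub_le_fejerCount (N : ℕ) (m : ℤ) : (N : ℤ) - |m| ≤ fejerCount N m := by
  have h : N - m.natAbs ≤ fejerCount N m := by
    rw [← Finset.card_range (N - m.natAbs)]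
    refine Finset.card_le_card_of_injOn (fun l => (l + m.toNat, l + (-m).toNat)) ?_ ?_
    · intro l hl
      simp only [Finset.coe_range, Set.mem_Iio] at hl
      simp only [Finset.coe_filter, Finset.mem_product, Set.mem_ofPred_eq, Finset.mem_range]
      omega
    · intro a _ b _ h
      simp only [Prod.mk.injEq] at h
      omega
  rcases abs_cases m with h1 | h1 <;> omega

/-- Grouping pairs by their difference. The range `M` is kept apart from the order `N` so that all
dyadic orders can later be summed over one common box. -/
theorem sum_fejerCount_mul {N M : ℕ} (hM : N ≤ M) (F : ℤ → ℂ) :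
    ∑ m ∈ Finset.Icc (-(M : ℤ)) M, (fejerCount N m : ℂ) * F m =
      ∑ p ∈ Finset.range N ×ˢ Finset.range N, F ((p.1 : ℤ) - p.2) := by
  rw [← Finset.sum_fiberwise_of_maps_to (s := Finset.range N ×ˢ Finset.range N)
    (t := Finset.Icc (-(M : ℤ)) M) (g := fun p : ℕ × ℕ => (p.1 : ℤ) - p.2)]
  · refine Finset.sum_congr rfl fun m _ => ?_
    rw [fejerCount, ← nsmul_eq_mul, ← Finset.sum_const]
    exact Finset.sum_congr rfl fun p hp => by rw [(Finset.mem_filter.1 hp).2]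
  · rintro ⟨a, b⟩ hp
    simp only [Finset.mem_product, Finset.mem_range] at hp
    simp only [Finset.mem_Icc]
    omega

theorem norm_sum_fejerCount_mul_zpow_le {N M : ℕ} (hM : N ≤ M) {z : ℂ} (hz : ‖z‖ = 1) :
    ‖∑ m ∈ Finset.Icc (-(M : ℤ)) M, (fejerCount N m : ℂ) * z ^ m‖ ≤ (N : ℝ) ^ 2 := by
  rw [sum_fejerCount_mul hM]
  refine (norm_sum_le_of_le _ (f := fun p : ℕ × ℕ => z ^ ((p.1 : ℤ) - p.2))
    (n := fun _ => (1 : ℝ)) fun p _ => ?_).trans ?_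
  · rw [norm_zpow, hz, one_zpow]
  · simp [sq]

theorem norm_pow_sub_one_le {z : ℂ} (hz : ‖z‖ = 1) (d : ℕ) : ‖z ^ d - 1‖ ≤ d * ‖z - 1‖ := by
  rw [← geom_sum_mul, norm_mul]
  gcongr
  refine (norm_sum_le_of_le _ (n := fun _ => (1 : ℝ)) fun i _ => ?_).trans (by simp)
  rw [norm_pow, hz, one_pow]

theorem norm_zpow_sub_one_le {z : ℂ} (hz : ‖z‖ = 1) (d : ℤ) : ‖z ^ d - 1‖ ≤ |(d : ℝ)| * ‖z - 1‖ := by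
  have hz0 : z ≠ 0 := fun h => by simp [h] at hz
  obtain ⟨k, rfl | rfl⟩ := d.eq_nat_or_neg
  · simpa using norm_pow_sub_one_le hz k
  · have h1 : z ^ (-(k : ℤ)) - 1 = -(z ^ (-(k : ℤ))) * (z ^ k - 1) := by
      rw [zpow_neg, zpow_natCast]
      field_simp
      ring
    rw [h1, norm_mul, norm_neg, norm_zpow, hz, one_zpow, one_mul]
    simpa using norm_pow_sub_one_le hz k

/-- Bound near `z = 1`. Swapping the two indices shows that the differences `a - b` sum to zero, so
`1` may be subtracted from each power; this is where oddness of the symbol is used. Each of the `N²`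
terms is then at most `N · N ‖z - 1‖`. -/
theorem norm_sum_fejerCount_mul_mul_zpow_le {N M : ℕ} (hM : N ≤ M) {z : ℂ} (hz : ‖z‖ = 1) :
    ‖∑ m ∈ Finset.Icc (-(M : ℤ)) M, (fejerCount N m : ℂ) * (m * z ^ m)‖ ≤
      (N : ℝ) ^ 4 * ‖z - 1‖ := by
  rw [sum_fejerCount_mul hM (fun m => (m : ℂ) * z ^ m)]
  have h0 : ∑ p ∈ Finset.range N ×ˢ Finset.range N, (((p.1 : ℤ) - p.2 : ℤ) : ℂ) = 0 := by
    push_cast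
    rw [Finset.sum_sub_distrib, Finset.sum_product, Finset.sum_product_right, sub_self]
  have h1 : ∑ p ∈ Finset.range N ×ˢ Finset.range N,
      (((p.1 : ℤ) - p.2 : ℤ) : ℂ) * z ^ ((p.1 : ℤ) - p.2) =
      ∑ p ∈ Finset.range N ×ˢ Finset.range N,
        (((p.1 : ℤ) - p.2 : ℤ) : ℂ) * (z ^ ((p.1 : ℤ) - p.2) - 1) := by
    simp only [mul_sub, mul_one]
    rw [Finset.sum_sub_distrib, h0, sub_zero]
  rw [h1]
  refine (norm_sum_le_of_le _ (n := fun _ => (N : ℝ) * (N * ‖z - 1‖)) fun p hp => ?_).trans ?_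
  · simp only [Finset.mem_product, Finset.mem_range] at hp
    have hd : |(((p.1 : ℤ) - p.2 : ℤ) : ℝ)| ≤ N := by
      rw [← Int.cast_abs]
      have : |(p.1 : ℤ) - p.2| ≤ N := by rw [abs_le]; omega
      exact_mod_cast this
    rw [norm_mul, Complex.norm_intCast]
    refine mul_le_mul hd ((norm_zpow_sub_one_le hz _).trans ?_) (norm_nonneg _) (by positivity)
    gcongr
  · simp only [Finset.sum_const, Finset.card_product, Finset.card_range, nsmul_eq_mul]
    push_cast
    exact le_of_eq (by ring)

/-- Decay away from `z = 1`. Writing `a - b` as a difference separates the double sum into products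
of `∑ z^l` and `∑ l z^l`, at `z` and `z⁻¹`. Multiplication by `z - 1` bounds the former by `2` and,
by Abel summation, the latter by `2N`. -/
theorem norm_sum_fejerCount_mul_mul_zpow_mul_sq_le {N M : ℕ} (hM : N ≤ M) {z : ℂ}
    (hz : ‖z‖ = 1) :
    ‖∑ m ∈ Finset.Icc (-(M : ℤ)) M, (fejerCount N m : ℂ) * (m * z ^ m)‖ * ‖z - 1‖ ^ 2 ≤
      8 * N := by
  have hz0 : z ≠ 0 := fun h => by simp [h] at hz
  rw [sum_fejerCount_mul hM (fun m => (m : ℂ) * z ^ m)]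
  have hw : ‖z⁻¹‖ = 1 := by rw [norm_inv, hz, inv_one]
  have hzw : ‖z⁻¹ - 1‖ = ‖z - 1‖ := by
    have : z⁻¹ - 1 = -(z⁻¹ * (z - 1)) := by field_simp; ring
    rw [this, norm_neg, norm_mul, hw, one_mul]
  have hD : ∀ y : ℂ, ‖y‖ = 1 → ‖∑ l ∈ Finset.range N, y ^ l‖ * ‖y - 1‖ ≤ 2 := by
    intro y hy
    rw [← norm_mul, geom_sum_mul]
    refine (norm_sub_le _ _).trans ?_
    rw [norm_pow, hy, one_pow, norm_one]
    norm_num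
  have hE : ∀ y : ℂ, ‖y‖ = 1 → ‖∑ l ∈ Finset.range N, (l : ℂ) * y ^ l‖ * ‖y - 1‖ ≤ 2 * N := by
    intro y hy
    have key : (∑ l ∈ Finset.range N, (l : ℂ) * y ^ l) * (y - 1) =
        N * y ^ N - ∑ l ∈ Finset.range N, y ^ (l + 1) := by
      clear hM hD
      induction N with
      | zero => simp
      | succ N ih =>
        rw [Finset.sum_range_succ, Finset.sum_range_succ, add_mul, ih]
        push_cast
        ring
    rw [← norm_mul, key]
    refine (norm_sub_le _ _).trans ?_
    have h1 : ‖∑ l ∈ Finset.range N, y ^ (l + 1)‖ ≤ N :=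
      (norm_sum_le_of_le _ (n := fun _ => (1 : ℝ)) fun i _ => by
        rw [norm_pow, hy, one_pow]).trans (by simp)
    have h2 : ‖(N : ℂ) * y ^ N‖ = N := by
      rw [norm_mul, norm_pow, hy, one_pow, mul_one, Complex.norm_natCast]
    linarith
  have hsplit : ∑ p ∈ Finset.range N ×ˢ Finset.range N,
      (((p.1 : ℤ) - p.2 : ℤ) : ℂ) * z ^ ((p.1 : ℤ) - p.2) =
      (∑ l ∈ Finset.range N, (l : ℂ) * z ^ l) * (∑ l ∈ Finset.range N, z⁻¹ ^ l) -
      (∑ l ∈ Finset.range N, z ^ l) * (∑ l ∈ Finset.range N, (l : ℂ) * z⁻¹ ^ l) := by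
    rw [Finset.sum_mul_sum, Finset.sum_mul_sum, ← Finset.sum_product', ← Finset.sum_product',
      ← Finset.sum_sub_distrib]
    refine Finset.sum_congr rfl fun p _ => ?_
    rw [zpow_sub₀ hz0, zpow_natCast, zpow_natCast, inv_pow]
    push_cast
    ring
  rw [hsplit]
  have e1 := hD z hz
  have e2 := hD z⁻¹ hw
  have e3 := hE z hz
  have e4 := hE z⁻¹ hw
  rw [hzw] at e2 e4
  set D := ‖∑ l ∈ Finset.range N, z ^ l‖
  set D' := ‖∑ l ∈ Finset.range N, z⁻¹ ^ l‖
  set E := ‖∑ l ∈ Finset.range N, (l : ℂ) * z ^ l‖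
  set E' := ‖∑ l ∈ Finset.range N, (l : ℂ) * z⁻¹ ^ l‖
  calc _ ≤ (E * D' + D * E') * ‖z - 1‖ ^ 2 := by
        gcongr
        refine (norm_sub_le _ _).trans ?_
        rw [norm_mul, norm_mul]
    _ = (E * ‖z - 1‖) * (D' * ‖z - 1‖) + (D * ‖z - 1‖) * (E' * ‖z - 1‖) := by ring
    _ ≤ (2 * N) * 2 + 2 * (2 * N) := by gcongr
    _ = 8 * N := by ring

/-! ### Dyadic sums -/

/-- With `b = 2^k δ` the bracket has size `min(b, 1/b)` and equals `G(2b) - G(b)` for `G(t) = t / (1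
+ t)`. The sum over scales telescopes, and `G` takes values in `[0, 1]`, so the bound depends
neither on `δ` nor on `K`. -/
theorem sum_range_dyadic_le {δ c : ℝ} (hδ : 0 < δ) (hc : 0 ≤ c) (F : ℕ → ℝ) (K : ℕ)
    (hF : ∀ k < K, F k ≤ c * (2 ^ k * δ / ((1 + 2 ^ k * δ) * (1 + 2 * (2 ^ k * δ))))) :
    ∑ k ∈ Finset.range K, F k ≤ c := by
  let G : ℕ → ℝ := fun k => 2 ^ k * δ / (1 + 2 ^ k * δ)
  have hG : ∀ k, 2 ^ k * δ / ((1 + 2 ^ k * δ) * (1 + 2 * (2 ^ k * δ))) = G (k + 1) - G k := by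
    intro k
    have h : 0 < 2 ^ k * δ := by positivity
    simp only [G, pow_succ, mul_comm ((2 : ℝ) ^ k) 2, mul_assoc]
    field_simp
    ring
  calc ∑ k ∈ Finset.range K, F k ≤ ∑ k ∈ Finset.range K, c * (G (k + 1) - G k) :=
        Finset.sum_le_sum fun k hk => by rw [← hG]; exact hF k (Finset.mem_range.1 hk)
    _ = c * (G K - G 0) := by rw [← Finset.mul_sum, Finset.sum_range_sub]
    _ ≤ c * 1 := by
        gcongr
        have h1 : G K ≤ 1 := div_le_one_of_le₀ (by linarith) (by positivity)
        have h0 : 0 ≤ G 0 := by positivity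
        linarith
    _ = c := mul_one c

/-- Converts the pair of bounds `b` and `8 / b²` into the telescoping form, separating `b ≤ 1` from
`b > 1`; the second case gives the constant `6 · 8 = 48`. -/
theorem le_dyadic_of_le_of_mul_sq_le {b x : ℝ} (hb : 0 < b) (h1 : x ≤ b) (h2 : x * b ^ 2 ≤ 8) :
    x ≤ 48 * (b / ((1 + b) * (1 + 2 * b))) := by
  rw [← mul_div_assoc, le_div_iff₀ (by positivity)]
  rcases le_or_gt b 1 with hb1 | hb1
  · calc x * ((1 + b) * (1 + 2 * b)) ≤ b * ((1 + b) * (1 + 2 * b)) := by gcongr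
      _ ≤ b * ((1 + 1) * (1 + 2 * 1)) := by gcongr
      _ ≤ 48 * b := by linarith
  · rcases le_or_gt x 0 with hx | hx
    · exact (mul_nonpos_of_nonpos_of_nonneg hx (by positivity)).trans (by positivity)
    calc x * ((1 + b) * (1 + 2 * b)) ≤ x * ((b + b) * (b + 2 * b)) := by gcongr
      _ = 6 * (x * b ^ 2) := by ring
      _ ≤ 48 * b := by linarith

/-! ### The weight on the lattice -/

variable {n : ℕ}

noncomputable section

/-- The Fejér multiplier of order `N` on the lattice. -/
def fejerWeight (N : ℕ) (m : Fin n → ℤ) : ℝ := ∏ i, (fejerCount N (m i) : ℝ) / N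

/-- A finitely supported dyadic weight, comparable to `|m|^{-n-1}` where `|m| ≤ 2^{K-2}`. -/
def dyadicWeight (K : ℕ) (m : Fin n → ℤ) : ℝ :=
  ∑ k ∈ Finset.range K, ((2 : ℝ) ^ k)⁻¹ ^ (n + 1) * fejerWeight (2 ^ k) m

/-- The lattice points with all coordinates at most `M` in absolute value. -/
def latticeBox (n M : ℕ) : Finset (Fin n → ℤ) :=
  Fintype.piFinset fun _ => Finset.Icc (-(M : ℤ)) M

theorem fejerWeight_nonneg (N : ℕ) (m : Fin n → ℤ) : 0 ≤ fejerWeight N m :=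
  Finset.prod_nonneg fun _ _ => by positivity

theorem fejerWeight_le_one (N : ℕ) (m : Fin n → ℤ) : fejerWeight N m ≤ 1 :=
  Finset.prod_le_one (fun _ _ => by positivity) fun i _ =>
    div_le_one_of_le₀ (by exact_mod_cast fejerCount_le N (m i)) (by positivity)

theorem dyadicWeight_nonneg (K : ℕ) (m : Fin n → ℤ) : 0 ≤ dyadicWeight K m :=
  Finset.sum_nonneg fun _ _ => mul_nonneg (by positivity) (fejerWeight_nonneg _ _)

theorem latticeNorm_nonneg (m : Fin n → ℤ) : 0 ≤ latticeNorm m := Real.sqrt_nonneg _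

theorem one_le_latticeNorm {m : Fin n → ℤ} (hm : m ≠ 0) : 1 ≤ latticeNorm m := by
  obtain ⟨j, hj⟩ := Function.ne_iff.1 hm
  refine le_trans ?_ (abs_le_latticeNorm m j)
  rw [← Int.cast_abs]
  exact_mod_cast Int.one_le_abs hj

theorem latticeNorm_le_of_forall_abs_le {m : Fin n → ℤ} {N : ℝ} (hN : 0 ≤ N)
    (h : ∀ i, |(m i : ℝ)| ≤ N) : latticeNorm m ≤ n * N := by
  refine Real.sqrt_le_iff.2 ⟨by positivity, ?_⟩
  calc ∑ j, (m j : ℝ) ^ 2 ≤ ∑ _j : Fin n, N ^ 2 := Finset.sum_le_sum fun j _ => by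
        rw [← sq_abs]
        have := h j
        gcongr
    _ = n * N ^ 2 := by simp
    _ ≤ (n * N) ^ 2 := by
      have : (n : ℝ) ≤ (n : ℝ) ^ 2 := by exact_mod_cast Nat.le_self_pow two_ne_zero n
      rw [mul_pow]
      gcongr

/-- The scales are compared through `b = 2^k n / |m|`. If `b < 1`, some coordinate of `m` exceeds
`2^k` and the Fejér weight vanishes; if `b ≥ 1`, the prefactor `2^{-k(n+1)}` alone decays
geometrically. -/
theorem dyadicWeight_le {m : Fin n → ℤ} (hm : m ≠ 0) (K : ℕ) :
    dyadicWeight K m ≤ 6 * (n / latticeNorm m) ^ (n + 1) := by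
  have hr := one_le_latticeNorm hm
  have hn : 0 < n := by
    rcases Nat.eq_zero_or_pos n with rfl | h
    · exact absurd (Subsingleton.elim m 0) hm
    · exact h
  have hn' : (0 : ℝ) < n := by exact_mod_cast hn
  set r := latticeNorm m with hrdef
  have hδ : 0 < n / r := by positivity
  refine sum_range_dyadic_le hδ (by positivity) _ K fun k _ => ?_
  set b := 2 ^ k * (n / r) with hb
  have hb0 : 0 < b := by positivity
  rcases le_or_gt 1 b with h1 | h1
  · have h2 : ((2 : ℝ) ^ k)⁻¹ = (n / r) * b⁻¹ := by
      rw [hb]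
      field_simp
    have h3 : b⁻¹ ^ (n + 1) ≤ b⁻¹ := by
      rw [pow_succ]
      exact mul_le_of_le_one_left (by positivity)
        (pow_le_one₀ (by positivity) (inv_le_one_of_one_le₀ h1))
    have h4 : b⁻¹ ≤ 6 * (b / ((1 + b) * (1 + 2 * b))) := by
      rw [← mul_div_assoc, le_div_iff₀ (by positivity), inv_mul_le_iff₀ hb0]
      nlinarith
    calc _ ≤ ((2 : ℝ) ^ k)⁻¹ ^ (n + 1) * 1 := by
          gcongr
          exact fejerWeight_le_one _ _
      _ = (n / r) ^ (n + 1) * b⁻¹ ^ (n + 1) := by rw [mul_one, h2, mul_pow]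
      _ ≤ (n / r) ^ (n + 1) * (6 * (b / ((1 + b) * (1 + 2 * b)))) := by
          gcongr
          exact h3.trans h4
      _ = _ := by ring
  · have h2 : ∃ i, (2 : ℝ) ^ k < |(m i : ℝ)| := by
      by_contra! hcon
      have := latticeNorm_le_of_forall_abs_le (by positivity) hcon
      rw [hb, ← mul_div_assoc, div_lt_one (by linarith)] at h1
      linarith
    obtain ⟨i, hi⟩ := h2
    have h3 : fejerWeight (2 ^ k) m = 0 := by
      refine Finset.prod_eq_zero (Finset.mem_univ i) ?_
      rw [fejerCount_eq_zero, Nat.cast_zero, zero_div]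
      have : ((2 ^ k : ℕ) : ℝ) ≤ ((|m i| : ℤ) : ℝ) := by
        push_cast
        exact hi.le
      exact_mod_cast this
    rw [h3, mul_zero]
    positivity

theorem le_dyadicWeight {m : Fin n → ℤ} (hm : m ≠ 0) {K : ℕ} (hK : 4 * latticeNorm m ≤ 2 ^ K) :
    (4 * latticeNorm m)⁻¹ ^ (n + 1) * 2⁻¹ ^ n ≤ dyadicWeight (K + 1) m := by
  have hr := one_le_latticeNorm hm
  -- Only the scale `k + 1` is kept: there `2|m| < 2^{k+1} ≤ 4|m|`, so each Fejér factor is at least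
  -- `1/2` and the prefactor is at least `(4|m|)^{-n-1}`.
  obtain ⟨k, hk1, hk2⟩ := exists_nat_pow_near (x := 2 * latticeNorm m) (y := 2) (by linarith)
    one_lt_two
  have hk3 : (2 : ℝ) ^ (k + 1) ≤ 4 * latticeNorm m := by
    rw [pow_succ]
    linarith
  have hkK : k + 1 ≤ K := (pow_le_pow_iff_right₀ one_lt_two).1 (hk3.trans hK)
  refine le_trans ?_ (Finset.single_le_sum (f := fun k => ((2 : ℝ) ^ k)⁻¹ ^ (n + 1) *
    fejerWeight (2 ^ k) m) (fun _ _ => mul_nonneg (by positivity) (fejerWeight_nonneg _ _))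
    (Finset.mem_range.2 (Nat.lt_succ_of_le hkK)))
  have h1 : (2⁻¹ : ℝ) ^ n ≤ fejerWeight (2 ^ (k + 1)) m := by
    calc (2⁻¹ : ℝ) ^ n = ∏ _i : Fin n, (2⁻¹ : ℝ) := by simp
      _ ≤ _ := Finset.prod_le_prod (fun _ _ => by norm_num) fun i _ => by
        have h2 := abs_le_latticeNorm m i
        have h3 : (((2 ^ (k + 1) : ℕ) : ℤ) : ℝ) - ((|m i| : ℤ) : ℝ) ≤
            ((fejerCount (2 ^ (k + 1)) (m i) : ℤ) : ℝ) := by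
          exact_mod_cast sub_le_fejerCount (2 ^ (k + 1)) (m i)
        push_cast at h3 ⊢
        rw [le_div_iff₀ (by positivity)]
        linarith
  gcongr

theorem fourier_eq_zpow (l : ℤ) (y : AddCircle (2 * Real.pi)) :
    fourier l y = (fourier 1 y : ℂ) ^ l := by
  simp [fourier_apply, AddCircle.toCircle_zsmul]

theorem norm_fourier_apply (l : ℤ) (y : AddCircle (2 * Real.pi)) : ‖(fourier l y : ℂ)‖ = 1 := by
  rw [fourier_apply]
  exact Circle.norm_coe _

theorem sum_fejerWeight_mul_character (N M : ℕ) (j : Fin n) (x : Torus n) :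
    ∑ m ∈ latticeBox n M, (fejerWeight N m : ℂ) * (m j * character m x) =
      ∏ i, (N : ℂ)⁻¹ * ∑ l ∈ Finset.Icc (-(M : ℤ)) M, (fejerCount N l : ℂ) *
        ((if i = j then (l : ℂ) else 1) * (fourier 1 (x i) : ℂ) ^ l) := by
  simp only [Finset.mul_sum]
  rw [Finset.prod_univ_sum]
  refine Finset.sum_congr rfl fun m _ => ?_
  simp only [fejerWeight, character, Complex.ofReal_prod, Finset.prod_mul_distrib,
    fourier_eq_zpow (m _), Finset.prod_ite_eq' Finset.univ j, Finset.mem_univ, if_true]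
  push_cast
  simp only [div_eq_mul_inv, Finset.prod_mul_distrib]
  ring

/-- The `n - 1` coordinates other than `j` contribute a Fejér kernel of size at most `N` each, and
coordinate `j` contributes `T / N`. The product is written with `N^n` in front to cancel against the
prefactor in `dyadicWeight`. -/
theorem norm_sum_fejerWeight_mul_character_le {N M : ℕ} (hN : 0 < N) (hM : N ≤ M) (j : Fin n)
    (x : Torus n) {T : ℝ}
    (hT : ‖∑ l ∈ Finset.Icc (-(M : ℤ)) M, (fejerCount N l : ℂ) *
      (l * (fourier 1 (x j) : ℂ) ^ l)‖ ≤ T) :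
    ‖∑ m ∈ latticeBox n M, (fejerWeight N m : ℂ) * (m j * character m x)‖ ≤
      (N : ℝ) ^ n * ((N : ℝ)⁻¹ ^ 2 * T) := by
  have hN' : (0 : ℝ) < N := by exact_mod_cast hN
  rw [sum_fejerWeight_mul_character, norm_prod, ← Finset.mul_prod_erase _ _ (Finset.mem_univ j)]
  have h1 : ∏ i ∈ Finset.univ.erase j, ‖(N : ℂ)⁻¹ * ∑ l ∈ Finset.Icc (-(M : ℤ)) M,
      (fejerCount N l : ℂ) * ((if i = j then (l : ℂ) else 1) * (fourier 1 (x i) : ℂ) ^ l)‖ ≤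
      ∏ _i ∈ Finset.univ.erase j, (N : ℝ) := by
    refine Finset.prod_le_prod (fun _ _ => norm_nonneg _) fun i hi => ?_
    simp only [if_neg (Finset.ne_of_mem_erase hi), one_mul]
    rw [norm_mul, norm_inv, Complex.norm_natCast, inv_mul_le_iff₀ hN', ← sq]
    exact norm_sum_fejerCount_mul_zpow_le hM (norm_fourier_apply _ _)
  have hT0 : 0 ≤ T := (norm_nonneg _).trans hT
  have hn : n = (n - 1) + 1 := (Nat.succ_pred_eq_of_pos (Fin.pos j)).symm
  rw [Finset.prod_const, Finset.card_erase_of_mem (Finset.mem_univ j), Finset.card_univ,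
    Fintype.card_fin] at h1
  simp only [if_true]
  rw [norm_mul, norm_inv, Complex.norm_natCast]
  calc _ ≤ ((N : ℝ)⁻¹ * T) * (N : ℝ) ^ (n - 1) := by gcongr
    _ = (N : ℝ) ^ n * ((N : ℝ)⁻¹ ^ 2 * T) := by
      conv_rhs => rw [hn, pow_succ]
      field_simp

/-- The kernel with Fourier coefficients `dyadicWeight K m * m_j` is bounded, uniformly in `K`. -/
theorem norm_sum_dyadicWeight_mul_character_le (K : ℕ) (j : Fin n) (x : Torus n) :
    ‖∑ m ∈ latticeBox n (2 ^ K), (dyadicWeight K m : ℂ) * m j * character m x‖ ≤ 48 := by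
  set z : ℂ := fourier 1 (x j) with hzdef
  have hz : ‖z‖ = 1 := norm_fourier_apply _ _
  have hsum : ∑ m ∈ latticeBox n (2 ^ K), (dyadicWeight K m : ℂ) * m j * character m x =
      ∑ k ∈ Finset.range K, (((2 : ℝ) ^ k)⁻¹ ^ (n + 1) : ℝ) *
        ∑ m ∈ latticeBox n (2 ^ K), (fejerWeight (2 ^ k) m : ℂ) * (m j * character m x) := by
    simp only [Finset.mul_sum]
    rw [Finset.sum_comm]
    refine Finset.sum_congr rfl fun m _ => ?_
    rw [dyadicWeight, mul_assoc, Complex.ofReal_sum, Finset.sum_mul]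
    refine Finset.sum_congr rfl fun k _ => ?_
    push_cast
    ring
  rw [hsum]
  refine (norm_sum_le _ _).trans ?_
  have hterm : ∀ k ∈ Finset.range K, ‖((((2 : ℝ) ^ k)⁻¹ ^ (n + 1) : ℝ) : ℂ) *
      ∑ m ∈ latticeBox n (2 ^ K), (fejerWeight (2 ^ k) m : ℂ) * (m j * character m x)‖ ≤
      ((2 : ℝ) ^ k)⁻¹ ^ 3 * ‖∑ l ∈ Finset.Icc (-((2 ^ K : ℕ) : ℤ)) (2 ^ K : ℕ),
        (fejerCount (2 ^ k) l : ℂ) * (l * z ^ l)‖ := by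
    intro k hk
    have hkK : 2 ^ k ≤ 2 ^ K := Nat.pow_le_pow_right two_pos (Finset.mem_range.1 hk).le
    rw [norm_mul, Complex.norm_real, Real.norm_of_nonneg (by positivity)]
    calc _ ≤ ((2 : ℝ) ^ k)⁻¹ ^ (n + 1) * _ := mul_le_mul_of_nonneg_left
          (norm_sum_fejerWeight_mul_character_le (by positivity) hkK j x le_rfl) (by positivity)
      _ = _ := by
        have h1 : ((2 : ℝ) ^ k)⁻¹ ^ n * (2 ^ k) ^ n = 1 := by
          rw [← mul_pow, inv_mul_cancel₀ (by positivity), one_pow]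
        rw [pow_succ]
        push_cast
        linear_combination ((2 : ℝ) ^ k)⁻¹ ^ 3 * ‖∑ l ∈ Finset.Icc (-(2 ^ K : ℤ)) (2 ^ K),
          (fejerCount (2 ^ k) l : ℂ) * (l * z ^ l)‖ * h1
  refine (Finset.sum_le_sum hterm).trans ?_
  -- At `z = 1` every term vanishes by the bound near `1`; otherwise the two bounds become `b` and
  -- `8 / b²` with `b = 2^k ‖z - 1‖`.
  rcases (norm_nonneg (z - 1)).eq_or_lt with h0 | hδ
  · refine (Finset.sum_nonpos fun k hk => ?_).trans (by norm_num)
    have hkK : 2 ^ k ≤ 2 ^ K := Nat.pow_le_pow_right two_pos (Finset.mem_range.1 hk).le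
    have := norm_sum_fejerCount_mul_mul_zpow_le hkK hz
    rw [← h0, mul_zero] at this
    exact mul_nonpos_of_nonneg_of_nonpos (by positivity) this
  · refine sum_range_dyadic_le hδ (by norm_num) _ K fun k hk => ?_
    have hkK : 2 ^ k ≤ 2 ^ K := Nat.pow_le_pow_right two_pos hk.le
    have h1 := norm_sum_fejerCount_mul_mul_zpow_le hkK hz
    have h2 := norm_sum_fejerCount_mul_mul_zpow_mul_sq_le hkK hz
    set T := ‖∑ l ∈ Finset.Icc (-((2 ^ K : ℕ) : ℤ)) (2 ^ K : ℕ),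
        (fejerCount (2 ^ k) l : ℂ) * (l * z ^ l)‖
    push_cast at h1 h2
    refine le_dyadic_of_le_of_mul_sq_le (by positivity) ?_ ?_
    · rw [inv_pow, inv_mul_le_iff₀ (by positivity)]
      exact h1.trans (le_of_eq (by ring))
    · have h3 : ((2 : ℝ) ^ k)⁻¹ ^ 3 * T * (2 ^ k * ‖z - 1‖) ^ 2 =
          ((2 : ℝ) ^ k)⁻¹ * (T * ‖z - 1‖ ^ 2) := by field_simp
      rw [h3, inv_mul_le_iff₀ (by positivity)]
      linarith

end

/-! ### Bilinear estimate for Fourier coefficients of integrable functions -/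

theorem fourierCoeff_add (u v : Distribution n) (m : Fin n → ℤ) :
    fourierCoeff (u + v) m = fourierCoeff u m + fourierCoeff v m := by
  simp [fourierCoeff, mul_add]

theorem fourierCoeff_sub (u v : Distribution n) (m : Fin n → ℤ) :
    fourierCoeff (u - v) m = fourierCoeff u m - fourierCoeff v m := by
  simp [fourierCoeff, mul_sub]

theorem fourierCoeff_ofIntegrable {g : Torus n → ℂ} (hg : Integrable g) (m : Fin n → ℤ) :
    fourierCoeff (ofIntegrable g hg) m =
      ((2 * Real.pi : ℂ) ^ n)⁻¹ * ∫ x, g x * character (-m) x := rfl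

theorem character_neg (m : Fin n → ℤ) (x : Torus n) :
    character (-m) x = starRingEnd ℂ (character m x) := by
  simp only [character, Pi.neg_apply, fourier_neg, map_prod]

theorem character_neg_right (m : Fin n → ℤ) (x : Torus n) :
    character m (-x) = character (-m) x := by
  simp [character, fourier_apply]

theorem integrable_mul_character {g : Torus n → ℂ} (hg : Integrable g) (m : Fin n → ℤ) :
    Integrable fun x => g x * character m x := integrable_mul_test hg (charTest m)

/-- Applied once in each variable of the bilinear form, this replaces Fubini's theorem, since the
sum over frequencies is finite. -/
theorem norm_sum_mul_integral_le {ι α : Type*} [MeasurableSpace α] {μ : Measure α}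
    (S : Finset ι) (a : ι → ℂ) {g : α → ℂ} (hg : Integrable g μ) (e : ι → α → ℂ)
    (he : ∀ i ∈ S, Integrable (fun x => g x * e i x) μ) {M : ℝ}
    (hM : ∀ x, ‖∑ i ∈ S, a i * e i x‖ ≤ M) :
    ‖∑ i ∈ S, a i * ∫ x, g x * e i x ∂μ‖ ≤ M * ∫ x, ‖g x‖ ∂μ := by
  have h : ∑ i ∈ S, a i * ∫ x, g x * e i x ∂μ = ∫ x, g x * ∑ i ∈ S, a i * e i x ∂μ := by
    simp only [← integral_const_mul]
    rw [← integral_finsetSum S fun i hi => (he i hi).const_mul _]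
    refine integral_congr_ae (Filter.Eventually.of_forall fun x => ?_)
    simp only [Finset.mul_sum]
    exact Finset.sum_congr rfl fun i _ => by ring
  rw [h, ← integral_const_mul]
  refine norm_integral_le_of_norm_le (hg.norm.const_mul M) (Filter.Eventually.of_forall fun x => ?_)
  rw [norm_mul, mul_comm]
  exact mul_le_mul_of_nonneg_right (hM x) (norm_nonneg _)

/-- Up to the factor `(2π)^{-2n} ≤ 1`, the sum is the double integral of `g(x) conj g'(y) k(y - x)`,
where `k` is the kernel with coefficients `c`; a uniform bound on `k` suffices. -/
theorem norm_sum_mul_fourierCoeff_mul_conj_le (S : Finset (Fin n → ℤ)) (c : (Fin n → ℤ) → ℂ)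
    {g g' : Torus n → ℂ} (hg : Integrable g) (hg' : Integrable g') {M : ℝ}
    (hM : ∀ x, ‖∑ m ∈ S, c m * character m x‖ ≤ M) :
    ‖∑ m ∈ S, c m * (fourierCoeff (ofIntegrable g hg) m *
      starRingEnd ℂ (fourierCoeff (ofIntegrable g' hg') m))‖ ≤
      M * ((∫ x, ‖g x‖) * ∫ x, ‖g' x‖) := by
  have hp : ‖((2 * Real.pi : ℂ) ^ n)⁻¹‖ ≤ 1 := by
    rw [norm_inv, norm_pow, norm_mul, Complex.norm_ofNat, Complex.norm_real,
      Real.norm_of_nonneg Real.pi_pos.le]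
    exact inv_le_one_of_one_le₀ (one_le_pow₀ (by linarith [Real.pi_gt_three]))
  set p := ((2 * Real.pi : ℂ) ^ n)⁻¹ with hpdef
  have hM0 : 0 ≤ M := (norm_nonneg _).trans (hM 0)
  have hconj : ∀ m, starRingEnd ℂ (fourierCoeff (ofIntegrable g' hg') m) =
      starRingEnd ℂ p * ∫ y, starRingEnd ℂ (g' y) * character m y := by
    intro m
    rw [fourierCoeff_ofIntegrable, map_mul, ← integral_conj]
    simp [character_neg, hpdef]
  have hg'c : Integrable fun y => starRingEnd ℂ (g' y) :=
    (LinearIsometryEquiv.integrable_comp_iff Complex.conjLIE).2 hg'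
  have hnorm : ∫ y, ‖starRingEnd ℂ (g' y)‖ = ∫ y, ‖g' y‖ := by simp
  have h1 : ∑ m ∈ S, c m * (fourierCoeff (ofIntegrable g hg) m *
      starRingEnd ℂ (fourierCoeff (ofIntegrable g' hg') m)) =
      p * starRingEnd ℂ p * ∑ m ∈ S, (c m * ∫ y, starRingEnd ℂ (g' y) * character m y) *
        ∫ x, g x * character (-m) x := by
    rw [Finset.mul_sum]
    refine Finset.sum_congr rfl fun m _ => ?_
    rw [hconj, fourierCoeff_ofIntegrable]
    ring
  have h2 : ∀ x, ‖∑ m ∈ S, (c m * ∫ y, starRingEnd ℂ (g' y) * character m y) *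
      character (-m) x‖ ≤ M * ∫ y, ‖g' y‖ := by
    intro x
    have h3 := norm_sum_mul_integral_le S (fun m => c m * character (-m) x) hg'c
      (fun m => character m) (fun m _ => integrable_mul_character hg'c m) (M := M) (fun y => by
        refine le_of_eq_of_le ?_ (hM (y + -x))
        congr 1
        refine Finset.sum_congr rfl fun m _ => ?_
        rw [character_add, character_neg_right]
        ring)
    rw [hnorm] at h3
    refine le_of_eq_of_le ?_ h3
    congr 1
    exact Finset.sum_congr rfl fun m _ => by ring
  have h4 := norm_sum_mul_integral_le S _ hg (fun m => character (-m))
    (fun m _ => integrable_mul_character hg (-m)) h2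
  rw [h1, norm_mul, norm_mul, RCLike.norm_conj]
  have hpp : ‖p‖ * ‖p‖ ≤ 1 := mul_le_one₀ hp (norm_nonneg _) hp
  refine (mul_le_of_le_one_left (norm_nonneg _) hpp).trans (h4.trans (le_of_eq ?_))
  ring

/-! ### The weighted estimate -/

/-- Used with `c = n`: summing `x² / (2n)` over the `n` Riesz transforms gives exactly half of the
quantity to be absorbed. -/
theorem abs_mul_add_le_young {x a b c : ℝ} (hn : 1 ≤ c) :
    x * a + b * x + b * a ≤ x ^ 2 / (2 * c) + (c + 1) * (a ^ 2 + b ^ 2) := by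
  have hc : 0 < c := by linarith
  have h1 : ∀ y : ℝ, x * y ≤ x ^ 2 / (4 * c) + c * y ^ 2 := by
    intro y
    have : x ^ 2 / (4 * c) + c * y ^ 2 - x * y = (x - 2 * c * y) ^ 2 / (4 * c) := by
      field_simp
      ring
    have h2 : 0 ≤ (x - 2 * c * y) ^ 2 / (4 * c) := by positivity
    linarith
  have h3 := h1 a
  have h4 := h1 b
  have h5 : x ^ 2 / (2 * c) = x ^ 2 / (4 * c) + x ^ 2 / (4 * c) := by
    field_simp
    ring
  nlinarith [sq_nonneg (a - b), sq_nonneg (a + b), sq_nonneg a, sq_nonneg b]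

theorem sum_sq_eq_latticeNorm_sq (m : Fin n → ℤ) : ∑ j, (m j : ℝ) ^ 2 = latticeNorm m ^ 2 :=
  (Real.sq_sqrt (Finset.sum_nonneg fun _ _ => sq_nonneg _)).symm

/-- The identity `∑_j m_j² / |m| = |m|`; at `m = 0` both sides vanish. -/
theorem latticeNorm_mul_eq_sum_riesz (v : Distribution n) (m : Fin n → ℤ) :
    (latticeNorm m : ℂ) * fourierCoeff v m =
      ∑ j, -(Complex.I * m j) * fourierCoeff (riesz j v) m := by
  have h1 : ∀ j, -(Complex.I * m j) * fourierCoeff (riesz j v) m =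
      (((m j : ℝ) ^ 2 / latticeNorm m : ℝ) : ℂ) * fourierCoeff v m := by
    intro j
    rw [riesz, fourierCoeff_multiplier]
    push_cast
    linear_combination (-(m j : ℂ) ^ 2 / latticeNorm m * fourierCoeff v m) * Complex.I_sq
  simp only [h1]
  rw [← Finset.sum_mul, ← Complex.ofReal_sum, ← Finset.sum_div, sum_sq_eq_latticeNorm_sq, sq]
  rcases eq_or_ne (latticeNorm m) 0 with h | h
  · simp [h]
  · rw [mul_div_cancel_right₀ _ h]

theorem norm_fourierCoeff_riesz_le (j : Fin n) (v : Distribution n) (m : Fin n → ℤ) :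
    ‖fourierCoeff (riesz j v) m‖ ≤ ‖fourierCoeff v m‖ := by
  rw [riesz, fourierCoeff_multiplier, norm_mul, norm_mul, Complex.norm_I, one_mul,
    Complex.norm_real, Real.norm_eq_abs, abs_div, abs_of_nonneg (latticeNorm_nonneg m)]
  exact mul_le_of_le_one_left (norm_nonneg _)
    (div_le_one_of_le₀ (abs_le_latticeNorm m j) (latticeNorm_nonneg m))

theorem norm_sum_weight_riesz_le {v : Distribution n} {g₀ : Torus n → ℂ} (hg₀ : Integrable g₀)
    {h₀ : Distribution n} (hv : v = ofIntegrable g₀ hg₀ + h₀) {j : Fin n}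
    {g : Torus n → ℂ} (hg : Integrable g) {h : Distribution n}
    (hR : riesz j v = ofIntegrable g hg + h) (S : Finset (Fin n → ℤ))
    {w : (Fin n → ℤ) → ℝ} (hw : ∀ m, 0 ≤ w m) {M : ℝ}
    (hM : ∀ x, ‖∑ m ∈ S, (w m : ℂ) * m j * character m x‖ ≤ M) :
    ‖∑ m ∈ S, (w m : ℂ) * m j *
      (fourierCoeff (riesz j v) m * starRingEnd ℂ (fourierCoeff v m))‖ ≤
      M * ((∫ x, ‖g x‖) * ∫ x, ‖g₀ x‖) +
      ∑ m ∈ S, w m * latticeNorm m * (‖fourierCoeff v m‖ ^ 2 / (2 * n) +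
        (n + 1) * (‖fourierCoeff h₀ m‖ ^ 2 + ‖fourierCoeff h m‖ ^ 2)) := by
  have hn : (1 : ℝ) ≤ n := by exact_mod_cast Fin.pos j
  -- Expanding `ĝ = (R_j v)^ - ĥ` and `ĝ₀ = v̂ - ĥ₀` leaves, beside the product of the two
  -- integrable parts, only terms containing `ĥ` or `ĥ₀`.
  have hsplit : ∀ m, (w m : ℂ) * m j *
      (fourierCoeff (riesz j v) m * starRingEnd ℂ (fourierCoeff v m)) =
      (w m : ℂ) * m j * (fourierCoeff (ofIntegrable g hg) m *
        starRingEnd ℂ (fourierCoeff (ofIntegrable g₀ hg₀) m)) +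
      (w m : ℂ) * m j * (fourierCoeff (riesz j v) m * starRingEnd ℂ (fourierCoeff h₀ m) +
        fourierCoeff h m * starRingEnd ℂ (fourierCoeff v m) -
        fourierCoeff h m * starRingEnd ℂ (fourierCoeff h₀ m)) := by
    intro m
    rw [show fourierCoeff (ofIntegrable g hg) m = fourierCoeff (riesz j v) m - fourierCoeff h m by
      rw [hR, fourierCoeff_add]; ring,
      show fourierCoeff (ofIntegrable g₀ hg₀) m = fourierCoeff v m - fourierCoeff h₀ m by
      rw [hv, fourierCoeff_add]; ring, map_sub]
    ring
  rw [Finset.sum_congr rfl fun m _ => hsplit m, Finset.sum_add_distrib]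
  refine (norm_add_le _ _).trans (add_le_add
    (norm_sum_mul_fourierCoeff_mul_conj_le S _ hg hg₀ hM) (norm_sum_le_of_le _ fun m _ => ?_))
  rw [norm_mul, norm_mul, Complex.norm_real, Real.norm_of_nonneg (hw m), Complex.norm_intCast]
  refine mul_le_mul (mul_le_mul_of_nonneg_left (abs_le_latticeNorm m j) (hw m)) ?_
    (norm_nonneg _) (mul_nonneg (hw m) (latticeNorm_nonneg m))
  refine le_trans ?_ (abs_mul_add_le_young hn)
  refine (norm_sub_le _ _).trans (add_le_add ((norm_add_le _ _).trans (add_le_add ?_ ?_)) ?_)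
  · rw [norm_mul, RCLike.norm_conj]
    exact mul_le_mul_of_nonneg_right (norm_fourierCoeff_riesz_le j v m) (norm_nonneg _)
  · rw [norm_mul, RCLike.norm_conj]
  · rw [norm_mul, RCLike.norm_conj]

theorem sum_weight_mul_latticeNorm_le (hn : 1 ≤ n) {v : Distribution n} {g₀ : Torus n → ℂ}
    (hg₀ : Integrable g₀) {h₀ : Distribution n} (hv : v = ofIntegrable g₀ hg₀ + h₀)
    {g : Fin n → Torus n → ℂ} (hg : ∀ j, Integrable (g j)) {h : Fin n → Distribution n}
    (hR : ∀ j, riesz j v = ofIntegrable (g j) (hg j) + h j) (S : Finset (Fin n → ℤ))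
    {w : (Fin n → ℤ) → ℝ} (hw : ∀ m, 0 ≤ w m) {M : ℝ}
    (hM : ∀ j x, ‖∑ m ∈ S, (w m : ℂ) * m j * character m x‖ ≤ M) :
    ∑ m ∈ S, w m * latticeNorm m * ‖fourierCoeff v m‖ ^ 2 ≤
      2 * ∑ j, (M * ((∫ x, ‖g j x‖) * ∫ x, ‖g₀ x‖) + (n + 1) *
        (∑ m ∈ S, w m * latticeNorm m * ‖fourierCoeff h₀ m‖ ^ 2 +
          ∑ m ∈ S, w m * latticeNorm m * ‖fourierCoeff (h j) m‖ ^ 2)) := by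
  set Y := ∑ m ∈ S, w m * latticeNorm m * ‖fourierCoeff v m‖ ^ 2 with hY
  have hn' : (0 : ℝ) < n := by exact_mod_cast hn
  have h1 : (Y : ℂ) = ∑ j, -Complex.I * ∑ m ∈ S, (w m : ℂ) * m j *
      (fourierCoeff (riesz j v) m * starRingEnd ℂ (fourierCoeff v m)) := by
    simp only [Finset.mul_sum]
    rw [Finset.sum_comm, hY, Complex.ofReal_sum]
    refine Finset.sum_congr rfl fun m _ => ?_
    push_cast
    rw [← Complex.mul_conj', mul_assoc (w m : ℂ), ← mul_assoc (latticeNorm m : ℂ),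
      latticeNorm_mul_eq_sum_riesz, Finset.sum_mul, Finset.mul_sum]
    exact Finset.sum_congr rfl fun j _ => by ring
  have h2 : Y ≤ ‖(Y : ℂ)‖ := by
    rw [Complex.norm_real]
    exact le_abs_self Y
  rw [h1] at h2
  have h4 : ∀ j, ∑ m ∈ S, w m * latticeNorm m * (‖fourierCoeff v m‖ ^ 2 / (2 * n) +
        (n + 1) * (‖fourierCoeff h₀ m‖ ^ 2 + ‖fourierCoeff (h j) m‖ ^ 2)) =
      Y / (2 * n) + (n + 1) *
        (∑ m ∈ S, w m * latticeNorm m * ‖fourierCoeff h₀ m‖ ^ 2 +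
          ∑ m ∈ S, w m * latticeNorm m * ‖fourierCoeff (h j) m‖ ^ 2) := by
    intro j
    rw [hY, Finset.sum_div, ← Finset.sum_add_distrib, Finset.mul_sum, ← Finset.sum_add_distrib]
    exact Finset.sum_congr rfl fun m _ => by ring
  have h3 : Y ≤ ∑ j, (M * ((∫ x, ‖g j x‖) * ∫ x, ‖g₀ x‖) + (Y / (2 * n) + (n + 1) *
      (∑ m ∈ S, w m * latticeNorm m * ‖fourierCoeff h₀ m‖ ^ 2 +
        ∑ m ∈ S, w m * latticeNorm m * ‖fourierCoeff (h j) m‖ ^ 2))) :=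
    h2.trans (norm_sum_le_of_le _ fun j _ => by
      rw [norm_mul, norm_neg, Complex.norm_I, one_mul, ← h4]
      exact norm_sum_weight_riesz_le hg₀ hv (hg j) (hR j) S hw (hM j))
  have h5 : ∑ _j : Fin n, Y / (2 * n) = Y / 2 := by
    rw [Finset.sum_const, Finset.card_univ, Fintype.card_fin, nsmul_eq_mul]
    field_simp
  -- Absorption: `Y ≤ Y / 2 + …`, legitimate because `Y` is a finite sum.
  simp only [Finset.sum_add_distrib, h5] at h3 ⊢
  linarith

/-! ### The a priori estimate -/

theorem sum_inv_latticeNorm_pow_mul_le {h : Distribution n}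
    (hh : sobolevNorm (-((n : ℝ) / 2)) h ≠ ⊤) (F : Finset (Fin n → ℤ)) (hF : ∀ m ∈ F, m ≠ 0) :
    ∑ m ∈ F, (latticeNorm m)⁻¹ ^ n * ‖fourierCoeff h m‖ ^ 2 ≤
      (sobolevNorm (-((n : ℝ) / 2)) h).toReal ^ 2 := by
  have h1 : ENNReal.ofReal (∑ m ∈ F, (latticeNorm m)⁻¹ ^ n * ‖fourierCoeff h m‖ ^ 2) ≤
      sobolevNorm (-((n : ℝ) / 2)) h ^ 2 := by
    have h2 : sobolevNorm (-((n : ℝ) / 2)) h ^ 2 = ∑' m : Fin n → ℤ,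
        ENNReal.ofReal (latticeNorm m) ^ (2 * (-((n : ℝ) / 2))) * ‖fourierCoeff h m‖ₑ ^ 2 := by
      rw [sobolevNorm, ← ENNReal.rpow_natCast, ← ENNReal.rpow_mul]
      norm_num
    rw [h2, ENNReal.ofReal_sum_of_nonneg fun m _ => by
      have := latticeNorm_nonneg m
      positivity]
    refine le_trans (Finset.sum_le_sum fun m hm => ?_) (ENNReal.sum_le_tsum F)
    have hr : 0 < latticeNorm m := zero_lt_one.trans_le (one_le_latticeNorm (hF m hm))
    rw [ENNReal.ofReal_mul (by positivity), ENNReal.ofReal_rpow_of_pos hr,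
      ENNReal.ofReal_pow (norm_nonneg _), ofReal_norm]
    refine mul_le_mul_left (ENNReal.ofReal_le_ofReal (le_of_eq ?_)) _
    rw [show 2 * (-((n : ℝ) / 2)) = -(n : ℝ) by ring, Real.rpow_neg hr.le, Real.rpow_natCast,
      inv_pow]
  rw [← ENNReal.toReal_pow]
  exact (ENNReal.ofReal_le_iff_le_toReal (ENNReal.pow_ne_top hh)).1 h1

theorem sum_dyadicWeight_mul_le {h : Distribution n}
    (hh : sobolevNorm (-((n : ℝ) / 2)) h ≠ ⊤) (K : ℕ) (S : Finset (Fin n → ℤ)) :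
    ∑ m ∈ S, dyadicWeight K m * latticeNorm m * ‖fourierCoeff h m‖ ^ 2 ≤
      6 * n ^ (n + 1) * (sobolevNorm (-((n : ℝ) / 2)) h).toReal ^ 2 := by
  classical
  -- The term `m = 0` carries the factor `|0| = 0`, so the upper bound for the weight is needed only
  -- off the origin.
  rw [← Finset.sum_erase S (a := 0) (by simp [latticeNorm])]
  refine le_trans ?_ (mul_le_mul_of_nonneg_left (sum_inv_latticeNorm_pow_mul_le hh
    (S.erase 0) fun m hm => Finset.ne_of_mem_erase hm) (by positivity))
  rw [Finset.mul_sum]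
  refine Finset.sum_le_sum fun m hm => ?_
  have hm0 := Finset.ne_of_mem_erase hm
  have hr : 0 < latticeNorm m := zero_lt_one.trans_le (one_le_latticeNorm hm0)
  calc _ ≤ 6 * (n / latticeNorm m) ^ (n + 1) * latticeNorm m * ‖fourierCoeff h m‖ ^ 2 := by
        gcongr
        exact dyadicWeight_le hm0 K
    _ = _ := by
        rw [div_eq_mul_inv, mul_pow, pow_succ (latticeNorm m)⁻¹]
        field_simp

theorem mul_add_mul_add_le {G G₀ N N₀ X X₀ B T k : ℝ} (hG₀ : 0 ≤ G₀) (hG : 0 ≤ G) (hN₀ : 0 ≤ N₀)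
    (hN : 0 ≤ N) (hB : 0 ≤ B) (hk : 0 ≤ k) (hT : G₀ + N₀ + (G + N) ≤ T) (hX₀ : X₀ ≤ B * N₀ ^ 2)
    (hX : X ≤ B * N ^ 2) : 48 * (G * G₀) + k * (X₀ + X) ≤ (48 + k * (2 * B)) * T ^ 2 := by
  have h1 : G * G₀ ≤ T ^ 2 := by
    rw [sq]
    exact mul_le_mul (by linarith) (by linarith) hG₀ (by linarith)
  have h2 : N₀ ^ 2 ≤ T ^ 2 := pow_le_pow_left₀ hN₀ (by linarith) 2
  have h3 : N ^ 2 ≤ T ^ 2 := pow_le_pow_left₀ hN (by linarith) 2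
  have h4 : X₀ + X ≤ 2 * B * T ^ 2 := by
    linarith [mul_le_mul_of_nonneg_left h2 hB, mul_le_mul_of_nonneg_left h3 hB]
  linarith [mul_le_mul_of_nonneg_left h4 hk]

theorem exists_sum_inv_latticeNorm_pow_mul_le (hn : 1 ≤ n) : ∃ A : ℝ, 0 < A ∧
    ∀ (v : Distribution n) (g₀ : Torus n → ℂ) (hg₀ : Integrable g₀) (h₀ : Distribution n),
    v = ofIntegrable g₀ hg₀ + h₀ → sobolevNorm (-((n : ℝ) / 2)) h₀ ≠ ⊤ →
    ∀ (g : Fin n → Torus n → ℂ) (hg : ∀ j, Integrable (g j)) (h : Fin n → Distribution n),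
    (∀ j, riesz j v = ofIntegrable (g j) (hg j) + h j) →
    (∀ j, sobolevNorm (-((n : ℝ) / 2)) (h j) ≠ ⊤) →
    ∀ F : Finset (Fin n → ℤ), (∀ m ∈ F, m ≠ 0) →
    ∑ m ∈ F, (latticeNorm m)⁻¹ ^ n * ‖fourierCoeff v m‖ ^ 2 ≤
      A * ((∫ x, ‖g₀ x‖) + (sobolevNorm (-((n : ℝ) / 2)) h₀).toReal +
        ∑ j, ((∫ x, ‖g j x‖) + (sobolevNorm (-((n : ℝ) / 2)) (h j)).toReal)) ^ 2 := by
  set B : ℝ := 6 * n ^ (n + 1) with hB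
  set c : ℝ := (4 : ℝ)⁻¹ ^ (n + 1) * 2⁻¹ ^ n with hc
  have hc0 : 0 < c := by positivity
  have hn' : (0 : ℝ) < n := by exact_mod_cast hn
  refine ⟨c⁻¹ * (2 * (n * (48 + (n + 1) * (2 * B)))), by positivity, ?_⟩
  intro v g₀ hg₀ h₀ hv hh₀ g hg h hR hh F hF
  set N₀ := (sobolevNorm (-((n : ℝ) / 2)) h₀).toReal
  set T := (∫ x, ‖g₀ x‖) + N₀ +
    ∑ j, ((∫ x, ‖g j x‖) + (sobolevNorm (-((n : ℝ) / 2)) (h j)).toReal) with hT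
  have hN₀ : 0 ≤ N₀ := ENNReal.toReal_nonneg
  have hG₀ : 0 ≤ ∫ x, ‖g₀ x‖ := integral_nonneg fun _ => norm_nonneg _
  have hG : ∀ j, 0 ≤ ∫ x, ‖g j x‖ := fun j => integral_nonneg fun _ => norm_nonneg _
  have hN : ∀ j, 0 ≤ (sobolevNorm (-((n : ℝ) / 2)) (h j)).toReal :=
    fun j => ENNReal.toReal_nonneg
  have hj : ∀ j, (∫ x, ‖g₀ x‖) + N₀ +
      ((∫ x, ‖g j x‖) + (sobolevNorm (-((n : ℝ) / 2)) (h j)).toReal) ≤ T := fun j => by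
    have := Finset.single_le_sum (f := fun j => (∫ x, ‖g j x‖) +
      (sobolevNorm (-((n : ℝ) / 2)) (h j)).toReal)
      (fun j _ => add_nonneg (hG j) (hN j)) (Finset.mem_univ j)
    linarith
  -- `K` depends on `F`, which is harmless since no constant depends on `K`. It is large enough for
  -- the lower bound on the weight at every point of `F`.
  obtain ⟨K, hK⟩ := pow_unbounded_of_one_lt (4 * ∑ m ∈ F, latticeNorm m) (one_lt_two)
  have hrK : ∀ m ∈ F, 4 * latticeNorm m ≤ 2 ^ K := fun m hm => by
    have := Finset.single_le_sum (f := latticeNorm) (fun m _ => latticeNorm_nonneg m) hm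
    linarith
  have hsub : F ⊆ latticeBox n (2 ^ (K + 1)) := by
    intro m hm
    rw [latticeBox, Fintype.mem_piFinset]
    intro i
    have h1 := (abs_le_latticeNorm m i).trans
      ((le_mul_of_one_le_left (latticeNorm_nonneg m) (by norm_num)).trans (hrK m hm))
    have h2 : |m i| ≤ 2 ^ K := by exact_mod_cast h1
    rw [Finset.mem_Icc, ← abs_le]
    refine h2.trans ?_
    push_cast
    exact pow_le_pow_right₀ one_le_two K.le_succ
  have hmain := sum_weight_mul_latticeNorm_le hn hg₀ hv hg hR (latticeBox n (2 ^ (K + 1)))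
    (dyadicWeight_nonneg (K + 1)) (norm_sum_dyadicWeight_mul_character_le (K + 1))
  have hlow : c * ∑ m ∈ F, (latticeNorm m)⁻¹ ^ n * ‖fourierCoeff v m‖ ^ 2 ≤
      ∑ m ∈ latticeBox n (2 ^ (K + 1)),
        dyadicWeight (K + 1) m * latticeNorm m * ‖fourierCoeff v m‖ ^ 2 := by
    rw [Finset.mul_sum]
    refine (Finset.sum_le_sum fun m hm => ?_).trans (Finset.sum_le_sum_of_subset_of_nonneg hsub
      fun m _ _ => mul_nonneg (mul_nonneg (dyadicWeight_nonneg _ m) (latticeNorm_nonneg m))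
        (sq_nonneg _))
    have hr : 0 < latticeNorm m := zero_lt_one.trans_le (one_le_latticeNorm (hF m hm))
    calc c * ((latticeNorm m)⁻¹ ^ n * ‖fourierCoeff v m‖ ^ 2) =
        (4 * latticeNorm m)⁻¹ ^ (n + 1) * 2⁻¹ ^ n * latticeNorm m * ‖fourierCoeff v m‖ ^ 2 := by
          rw [hc, mul_inv, mul_pow, pow_succ (latticeNorm m)⁻¹]
          field_simp
      _ ≤ _ := by
          gcongr
          exact le_dyadicWeight (hF m hm) (hrK m hm)
  have hup : ∀ j, (48 * ((∫ x, ‖g j x‖) * ∫ x, ‖g₀ x‖) + (n + 1) *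
      (∑ m ∈ latticeBox n (2 ^ (K + 1)),
        dyadicWeight (K + 1) m * latticeNorm m * ‖fourierCoeff h₀ m‖ ^ 2 +
      ∑ m ∈ latticeBox n (2 ^ (K + 1)),
        dyadicWeight (K + 1) m * latticeNorm m * ‖fourierCoeff (h j) m‖ ^ 2)) ≤
      (48 + (n + 1) * (2 * B)) * T ^ 2 := by
    intro j
    exact mul_add_mul_add_le hG₀ (hG j) hN₀ (hN j) (by positivity) (by positivity) (hj j)
      (sum_dyadicWeight_mul_le hh₀ (K + 1) _) (sum_dyadicWeight_mul_le (hh j) (K + 1) _)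
  have hsum := hmain.trans (mul_le_mul_of_nonneg_left (Finset.sum_le_sum fun j _ => hup j)
    zero_le_two)
  rw [Finset.sum_const, Finset.card_univ, Fintype.card_fin, nsmul_eq_mul] at hsum
  rw [mul_assoc c⁻¹, ← div_eq_inv_mul, le_div_iff₀ hc0, mul_comm]
  refine hlow.trans (hsum.trans (le_of_eq ?_))
  ring

noncomputable section

/-! ### Fourier series of test functions -/

/-- The character `x ↦ e^{i⟨m, x⟩}` as a continuous function. -/
def charCont (m : Fin n → ℤ) : C(Torus n, ℂ) := ⟨character m, (charTest m).continuous⟩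

theorem charCont_apply (m : Fin n → ℤ) (x : Torus n) : charCont m x = character m x := rfl

theorem integrable_continuousMap (f : C(Torus n, ℂ)) : Integrable f :=
  f.continuous.integrable_of_hasCompactSupport (HasCompactSupport.of_compactSpace _)

/-- The functional `p ↦ ∫ ψ p` on continuous functions. -/
def integralMul (ψ : C(Torus n, ℂ)) : C(Torus n, ℂ) →L[ℂ] ℂ :=
  LinearMap.mkContinuous
    { toFun := fun p => ∫ x, ψ x * p x
      map_add' := fun p q => by
        simp only [ContinuousMap.add_apply, mul_add]
        exact integral_add (integrable_continuousMap (ψ * p)) (integrable_continuousMap (ψ * q))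
      map_smul' := fun c p => by
        rw [RingHom.id_apply, smul_eq_mul, ← integral_const_mul]
        simp only [ContinuousMap.smul_apply, smul_eq_mul, mul_left_comm] }
    (‖ψ‖ * (volume : Measure (Torus n)).real Set.univ) fun p => by
      refine (norm_integral_le_of_norm_le_const (C := ‖ψ‖ * ‖p‖)
        (Filter.Eventually.of_forall fun x => ?_)).trans (le_of_eq (by ring))
      rw [norm_mul]
      exact mul_le_mul (ψ.norm_coe_le_norm x) (p.norm_coe_le_norm x) (norm_nonneg _)
        (norm_nonneg _)

theorem integralMul_apply (ψ p : C(Torus n, ℂ)) : integralMul ψ p = ∫ x, ψ x * p x := rfl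

/-- The star subalgebra of `C(T^n, ℂ)` generated by the characters. -/
def charSubalgebra (n : ℕ) : StarSubalgebra ℂ C(Torus n, ℂ) where
  toSubalgebra := Algebra.adjoin ℂ (Set.range charCont)
  star_mem' := by
    change Algebra.adjoin ℂ (Set.range charCont) ≤ star (Algebra.adjoin ℂ (Set.range charCont))
    refine Algebra.adjoin_le ?_
    rintro _ ⟨m, rfl⟩
    refine Algebra.subset_adjoin ⟨-m, ?_⟩
    ext x
    simp only [charCont_apply, character_neg, starRingEnd_apply, ContinuousMap.star_apply]

theorem character_add_left (m k : Fin n → ℤ) (x : Torus n) :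
    character (m + k) x = character m x * character k x := by
  simp [character, Finset.prod_mul_distrib]

theorem character_zero (x : Torus n) : character 0 x = 1 := by simp [character]

/-- Characters are closed under products, so the algebra they generate is their linear span. -/
theorem charSubalgebra_coe :
    (charSubalgebra n).toSubalgebra.toSubmodule = Submodule.span ℂ (Set.range charCont) := by
  apply Algebra.adjoin_eq_span_of_subset
  refine .trans (fun x ↦ Submonoid.closure_induction (fun _ ↦ id) ⟨0, ?_⟩ ?_) Submodule.subset_span
  · ext x
    exact character_zero x
  · rintro _ _ _ _ ⟨m, rfl⟩ ⟨k, rfl⟩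
    exact ⟨m + k, ContinuousMap.ext fun x => character_add_left m k x⟩

theorem charSubalgebra_separatesPoints : (charSubalgebra n).SeparatesPoints := by
  intro x y hxy
  obtain ⟨i, hi⟩ := Function.ne_iff.1 hxy
  refine ⟨_, ⟨charCont (Pi.single i 1), Algebra.subset_adjoin ⟨Pi.single i 1, rfl⟩, rfl⟩, ?_⟩
  have h : ∀ z : Torus n, character (Pi.single i 1) z = fourier 1 (z i) := by
    intro z
    rw [character, Finset.prod_eq_single i]
    · rw [Pi.single_eq_same]
    · intro j _ hj
      rw [Pi.single_eq_of_ne hj, fourier_zero]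
    · simp
  change character _ x ≠ character _ y
  rw [h, h, fourier_one, fourier_one]
  exact fun he => hi (AddCircle.injective_toCircle Real.two_pi_pos.ne' (Circle.coe_injective he))

theorem span_charCont_closure_eq_top :
    (Submodule.span ℂ (Set.range (charCont (n := n)))).topologicalClosure = ⊤ := by
  rw [← charSubalgebra_coe]
  exact congr_arg (Subalgebra.toSubmodule <| StarSubalgebra.toSubalgebra ·)
    (ContinuousMap.starSubalgebra_topologicalClosure_eq_top_of_separatesPoints _
      charSubalgebra_separatesPoints)

/-- By Stone–Weierstrass the functional `p ↦ ∫ ψ p` vanishes on all continuous `p`, in particular on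
the conjugate of `ψ`. -/
theorem eq_zero_of_integral_mul_character_eq_zero (ψ : C(Torus n, ℂ))
    (h : ∀ m, ∫ x, ψ x * character m x = 0) : ψ = 0 := by
  have h1 : integralMul ψ = 0 := by
    refine ContinuousLinearMap.ext_on (s := Set.range charCont) ?_ ?_
    · exact Submodule.dense_iff_topologicalClosure_eq_top.2 span_charCont_closure_eq_top
    · rintro _ ⟨m, rfl⟩
      exact h m
  have h2 : ∫ x, ‖ψ x‖ ^ 2 = 0 := by
    have h3 : integralMul ψ (star ψ) = 0 := by rw [h1]; rfl
    rw [integralMul_apply] at h3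
    have h4 : ∀ x, ψ x * (star ψ) x = ((‖ψ x‖ ^ 2 : ℝ) : ℂ) := fun x => by
      rw [ContinuousMap.star_apply]
      push_cast
      exact Complex.mul_conj' _
    simp only [h4, integral_complex_ofReal] at h3
    exact_mod_cast h3
  have hc : Continuous fun x => ‖ψ x‖ ^ 2 := by fun_prop
  have h5 := (integral_eq_zero_iff_of_nonneg (fun x => sq_nonneg ‖ψ x‖)
    (hc.integrable_of_hasCompactSupport (HasCompactSupport.of_compactSpace _))).1 h2
  have h6 := (hc.ae_eq_iff_eq volume continuous_const).1 h5
  ext x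
  have h7 : ‖ψ x‖ ^ 2 = 0 := congrFun h6 x
  simpa using h7

/-- The Fourier coefficient `(2π)^{-n} ∫ φ e^{-i⟨m, x⟩} dx` of a test function. -/
def testCoeff (φ : TestFunction n) (m : Fin n → ℤ) : ℂ :=
  ((2 * Real.pi : ℂ) ^ n)⁻¹ * pairing (-m) φ

theorem summable_testCoeff_mul (φ : TestFunction n) (k : ℕ) :
    Summable fun m => ‖testCoeff φ m‖ * (1 + ‖m‖) ^ k := by
  have hp : PolyGrowth fun m : Fin n → ℤ => (((1 + ‖m‖) ^ k : ℝ) : ℂ) := by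
    refine ⟨1, k, zero_le_one, fun m => ?_⟩
    rw [Complex.norm_real, Real.norm_of_nonneg (by positivity), one_mul]
  have h1 := (((summable_coeff_mul_pairing hp φ).norm).comp_injective
    (neg_injective (G := Fin n → ℤ))).mul_left ‖((2 * Real.pi : ℂ) ^ n)⁻¹‖
  refine h1.congr fun m => ?_
  simp only [Function.comp_apply, norm_neg, norm_mul, testCoeff, Complex.norm_real]
  rw [Real.norm_of_nonneg (by positivity)]
  ring

theorem summable_testCoeff (φ : TestFunction n) : Summable fun m => ‖testCoeff φ m‖ := by
  simpa using summable_testCoeff_mul φ 0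

theorem integral_character_mul_character_neg (m k : Fin n → ℤ) :
    ∫ x, character m x * character (-k) x = if m = k then (2 * Real.pi : ℂ) ^ n else 0 :=
  pairing_charTest_neg m k

theorem two_pi_pow_ne_zero (n : ℕ) : (2 * Real.pi : ℂ) ^ n ≠ 0 :=
  pow_ne_zero _ (by exact_mod_cast Real.two_pi_pos.ne')

/-- The series converges uniformly by absolute summability, and its sum minus `φ` is continuous with
all Fourier coefficients zero. -/
theorem hasSum_testCoeff_mul_character (φ : TestFunction n) (x : Torus n) :
    HasSum (fun m => testCoeff φ m * character m x) (φ x) := by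
  have hs : Summable fun m => testCoeff φ m • charCont m := by
    refine Summable.of_norm_bounded (summable_testCoeff φ) fun m => ?_
    rw [norm_smul]
    refine mul_le_of_le_one_right (norm_nonneg _) ?_
    exact (ContinuousMap.norm_le _ zero_le_one).2 fun x => (norm_character m x).le
  have h0 : (∑' m, testCoeff φ m • charCont m) - ⟨φ, φ.continuous⟩ = 0 := by
    refine eq_zero_of_integral_mul_character_eq_zero _ fun k => ?_
    have h1 : integralMul (charCont k) ((∑' m, testCoeff φ m • charCont m) -
        ⟨φ, φ.continuous⟩) = 0 := by
      have h2 : integralMul (charCont k) ⟨φ, φ.continuous⟩ = pairing k φ := rfl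
      rw [map_sub, (integralMul (charCont k)).map_tsum hs, tsum_eq_single (-k), h2]
      · rw [map_smul, integralMul_apply]
        simp only [charCont_apply]
        rw [integral_character_mul_character_neg, if_pos rfl, testCoeff, neg_neg, smul_eq_mul]
        field_simp [two_pi_pow_ne_zero n]
        ring
      · intro m hm
        rw [map_smul, integralMul_apply]
        simp only [charCont_apply]
        have := integral_character_mul_character_neg k (-m)
        rw [neg_neg] at this
        rw [this, if_neg (fun h => hm (by rw [h, neg_neg])), smul_zero]
    rw [integralMul_apply] at h1
    rw [← h1]
    refine integral_congr_ae (Filter.Eventually.of_forall fun x => mul_comm _ _)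
  have h3 := hs.hasSum.mapL (ContinuousMap.evalCLM ℂ x)
  rw [sub_eq_zero.1 h0] at h3
  exact h3

/-- The Fourier series of a test function converges in `C^∞(T^n)`. -/
theorem hasSum_testCoeff_smul_charTest (φ : TestFunction n) :
    HasSum (fun m => testCoeff φ m • charTest m) φ := by
  have hb : ∀ k : ℕ, Summable fun m => ‖testCoeff φ m‖ * (n * ‖m‖) ^ k := by
    intro k
    refine Summable.of_nonneg_of_le (fun m => by positivity) (fun m => ?_)
      ((summable_testCoeff_mul φ k).mul_left ((n : ℝ) ^ k))
    rw [mul_pow, mul_left_comm]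
    gcongr
    linarith
  refine ((TestFunction.withSeminorms n).tendsto_nhds _ _).2 fun k ε hε => ?_
  have ht := tendsto_tsum_compl_atTop_zero fun m => ‖testCoeff φ m‖ * (n * ‖m‖) ^ k
  filter_upwards [ht.eventually_lt_const hε] with F hF
  refine lt_of_le_of_lt ?_ hF
  change TestFunction.seminorm n k _ ≤ _
  rw [map_sub_rev]
  refine TestFunction.seminorm_le _ _ fun x => ?_
  have hlift : (φ - ∑ m ∈ F, testCoeff φ m • charTest m).lift =
      fun y => ∑' m : {m // m ∉ F}, (testCoeff φ m • charTest (m : Fin n → ℤ)).lift y := by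
    funext y
    have h1 := (hasSum_testCoeff_mul_character φ (proj y))
    have h2 := h1.summable.sum_add_tsum_subtype_compl F
    rw [h1.tsum_eq] at h2
    have h3 : ∀ G : Finset (Fin n → ℤ), (∑ m ∈ G, testCoeff φ m • charTest m).lift y =
        ∑ m ∈ G, testCoeff φ m * character m (proj y) := by
      classical
      intro G
      induction G using Finset.induction_on with
      | empty => rfl
      | insert a s ha ih =>
        rw [Finset.sum_insert ha, Finset.sum_insert ha, TestFunction.lift_add, Pi.add_apply, ih]
        rfl
    change φ (proj y) - (∑ m ∈ F, testCoeff φ m • charTest m).lift y = _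
    rw [h3, ← h2, add_sub_cancel_left]
    rfl
  have hterm : ∀ (k : ℕ) (m : Fin n → ℤ) (x : Fin n → ℝ),
      ‖iteratedFDeriv ℝ k (testCoeff φ m • charTest m).lift x‖ ≤
      ‖testCoeff φ m‖ * (n * ‖m‖) ^ k := by
    intro k m x
    refine (TestFunction.norm_iteratedFDeriv_le_seminorm _ k x).trans ?_
    rw [map_smul_eq_mul]
    gcongr
    exact seminorm_charTest_le m k
  have hs : ∀ k : ℕ, Summable fun m : {m // m ∉ F} =>
      ‖testCoeff φ m‖ * (n * ‖(m : Fin n → ℤ)‖) ^ k :=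
    fun k => (hb k).comp_injective Subtype.val_injective
  -- The remainder after `F` is differentiated term by term; its `k`-th seminorm is at most a tail
  -- of the summable series in `hb k`.
  have hD := iteratedFDeriv_tsum (𝕜 := ℝ) (N := (⊤ : ℕ∞)) (k := k)
    (f := fun m : {m // m ∉ F} => (testCoeff φ m • charTest (m : Fin n → ℤ)).lift)
    (fun m => TestFunction.contDiff_lift _) (fun k _ => hs k) (fun k m x _ => hterm k m x)
    (by exact_mod_cast le_top)
  rw [hlift, hD]
  exact tsum_of_norm_bounded (hs k).hasSum fun m => hterm k m x

/-- Continuity of `u` and `v` passes equality on characters to every test function through its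
Fourier series in `C^∞`. -/
theorem ext_fourierCoeff {u v : Distribution n} (h : ∀ m, fourierCoeff u m = fourierCoeff v m) :
    u = v := by
  have h1 : ∀ m : Fin n → ℤ, u (charTest m) = v (charTest m) := by
    intro m
    have := h (-m)
    rw [fourierCoeff, fourierCoeff, neg_neg] at this
    exact mul_left_cancel₀ (inv_ne_zero (two_pi_pow_ne_zero n)) this
  ext φ
  have h2 := (hasSum_testCoeff_smul_charTest φ).mapL u
  have h3 := (hasSum_testCoeff_smul_charTest φ).mapL v
  simp only [map_smul, h1] at h2 h3
  exact h2.unique h3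

end

noncomputable section

/-! ### Square integrable functions with given Fourier coefficients -/

theorem memLp_character (m : Fin n → ℤ) : MemLp (character m) 2 volume :=
  MemLp.of_bound (charTest m).continuous.aestronglyMeasurable 1
    (Filter.Eventually.of_forall fun x => (norm_character m x).le)

/-- The characters, normalized in `L²(T^n)`. -/
def charLp (m : Fin n → ℤ) : Lp ℂ 2 (volume : Measure (Torus n)) :=
  (((Real.sqrt ((2 * Real.pi) ^ n))⁻¹ : ℝ) : ℂ) • (memLp_character m).toLp

theorem inner_toLp_character (m : Fin n → ℤ) (f : Lp ℂ 2 (volume : Measure (Torus n))) :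
    inner ℂ ((memLp_character m).toLp) f = ∫ x, f x * character (-m) x := by
  rw [L2.inner_def]
  refine integral_congr_ae ?_
  filter_upwards [(memLp_character m).coeFn_toLp] with x hx
  rw [hx, RCLike.inner_apply, character_neg]

theorem orthonormal_charLp : Orthonormal ℂ (charLp (n := n)) := by
  classical
  rw [orthonormal_iff_ite]
  intro m k
  have h : inner ℂ ((memLp_character m).toLp) ((memLp_character k).toLp) =
      if m = k then (2 * Real.pi : ℂ) ^ n else 0 := by
    rw [inner_toLp_character]
    simp only [eq_comm (a := m)]
    rw [← integral_character_mul_character_neg k m]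
    refine integral_congr_ae ?_
    filter_upwards [(memLp_character k).coeFn_toLp] with x hx
    rw [hx]
  rw [charLp, charLp, inner_smul_left, inner_smul_right, h, Complex.conj_ofReal]
  split_ifs
  · have h1 : Real.sqrt ((2 * Real.pi) ^ n) * Real.sqrt ((2 * Real.pi) ^ n) = (2 * Real.pi) ^ n :=
      Real.mul_self_sqrt (by positivity)
    have h2 : (Real.sqrt ((2 * Real.pi) ^ n))⁻¹ * ((Real.sqrt ((2 * Real.pi) ^ n))⁻¹ *
        (2 * Real.pi) ^ n) = 1 := by
      nth_rewrite 3 [← h1]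
      have : Real.sqrt ((2 * Real.pi) ^ n) ≠ 0 := (Real.sqrt_pos.2 (by positivity)).ne'
      field_simp
    exact_mod_cast h2
  · simp

/-- Riesz–Fischer. The factor `s = (2π)^{n/2}` undoes the normalization of `charLp`, and partial
sums have squared norm `(2π)^n ∑ |a_m|²`. The bound is stated for every `Q` so that one `f` serves
all near-optimal decompositions. -/
theorem exists_memLp_fourierCoeff_eq (a : (Fin n → ℤ) → ℂ) (ha : Summable fun m => ‖a m‖ ^ 2) :
    ∃ (f : Torus n → ℂ) (hf : MemLp f 2 volume),
      (∀ m, fourierCoeff (ofIntegrable f (hf.integrable one_le_two)) m = a m) ∧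
      ∀ Q : ℝ, (∀ F : Finset (Fin n → ℤ), ∑ m ∈ F, ‖a m‖ ^ 2 ≤ Q) →
        eLpNorm f 2 volume ≤ ENNReal.ofReal (Real.sqrt ((2 * Real.pi) ^ n * Q)) := by
  classical
  set s : ℝ := Real.sqrt ((2 * Real.pi) ^ n) with hs
  have hs0 : s ≠ 0 := (Real.sqrt_pos.2 (by positivity)).ne'
  have hs2 : s ^ 2 = (2 * Real.pi) ^ n := Real.sq_sqrt (by positivity)
  have hV := (orthonormal_charLp (n := n)).orthogonalFamily
  have hsum : Summable fun m => ((s : ℂ) * a m) • charLp m := by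
    refine (hV.summable_iff_norm_sq_summable fun m => (s : ℂ) * a m).2 ?_
    refine (ha.mul_left (s ^ 2)).congr fun m => ?_
    rw [norm_mul, mul_pow, Complex.norm_real, Real.norm_eq_abs, sq_abs]
  obtain ⟨f, hf⟩ := hsum
  refine ⟨f, Lp.memLp f, fun m => ?_, fun Q hQ => ?_⟩
  · rw [fourierCoeff_ofIntegrable, ← inner_toLp_character]
    have h1 : (memLp_character m).toLp = (s : ℂ) • charLp m := by
      rw [charLp, smul_smul, ← hs, ← Complex.ofReal_mul, mul_inv_cancel₀ hs0, Complex.ofReal_one,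
        one_smul]
    have h2 := hf.mapL (innerSL ℂ (charLp m))
    simp only [innerSL_apply_apply, inner_smul_right, orthonormal_iff_ite.1 orthonormal_charLp]
      at h2
    have h3 := h2.unique (hasSum_single m fun k hk => by rw [if_neg (Ne.symm hk), mul_zero])
    have h4 : (s : ℂ) ^ 2 = (2 * Real.pi : ℂ) ^ n := by exact_mod_cast hs2
    rw [h1, inner_smul_left, h3, if_pos rfl, Complex.conj_ofReal, mul_one, ← mul_assoc (s : ℂ),
      ← sq, h4, inv_mul_cancel_left₀ (two_pi_pow_ne_zero n)]
  · have h1 : ‖f‖ ≤ Real.sqrt ((2 * Real.pi) ^ n * Q) := by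
      refine le_of_tendsto hf.norm (Filter.Eventually.of_forall fun F => Real.le_sqrt_of_sq_le ?_)
      have h2 := hV.norm_sum (fun m => (s : ℂ) * a m) F
      simp only [LinearIsometry.toSpanSingleton_apply] at h2
      rw [h2, ← hs2]
      calc ∑ m ∈ F, ‖(s : ℂ) * a m‖ ^ 2 = s ^ 2 * ∑ m ∈ F, ‖a m‖ ^ 2 := by
            rw [Finset.mul_sum]
            refine Finset.sum_congr rfl fun m _ => ?_
            rw [norm_mul, mul_pow, Complex.norm_real, Real.norm_eq_abs, sq_abs]
        _ ≤ _ := by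
            gcongr
            exact hQ F
    rw [← Lp.enorm_def, ← ofReal_norm]
    exact ENNReal.ofReal_le_ofReal h1

/-! ### Sums of spaces -/

theorem sumNorm_ne_top {s : ℝ} {v : Distribution n} (hv : MemSum s v) : sumNorm s v ≠ ⊤ := by
  obtain ⟨g, hg, h, hh, rfl⟩ := hv
  refine ne_top_of_le_ne_top ?_ (iInf_le_of_le g (iInf_le_of_le hg (iInf_le_of_le h
    (iInf_le_of_le rfl le_rfl))))
  exact ENNReal.add_ne_top.2 ⟨(memLp_one_iff_integrable.2 hg).2.ne, hh.ne⟩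

theorem exists_decomposition_le {s : ℝ} {v : Distribution n} (hv : MemSum s v) {ε : ℝ≥0∞}
    (hε : ε ≠ 0) : ∃ (g : Torus n → ℂ) (hg : Integrable g) (h : Distribution n),
      v = ofIntegrable g hg + h ∧ sobolevNorm s h ≠ ⊤ ∧
      ENNReal.ofReal ((∫ x, ‖g x‖) + (sobolevNorm s h).toReal) ≤ sumNorm s v + ε := by
  have h1 := ENNReal.lt_add_right (sumNorm_ne_top hv) hε
  conv_lhs at h1 => rw [sumNorm]
  simp only [iInf_lt_iff] at h1
  obtain ⟨g, hg, h, hvgh, hlt⟩ := h1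
  have hh : sobolevNorm s h ≠ ⊤ := (ENNReal.add_lt_top.1 (hlt.trans_le le_top)).2.ne
  refine ⟨g, hg, h, hvgh, hh, le_trans (le_of_eq ?_) hlt.le⟩
  rw [ENNReal.ofReal_add (integral_nonneg fun _ => norm_nonneg _) ENNReal.toReal_nonneg,
    ENNReal.ofReal_toReal hh, ofReal_integral_norm_eq_lintegral_enorm hg,
    eLpNorm_one_eq_lintegral_enorm]

/-! ### The fractional Laplacian and the mean -/

theorem inv_latticeNorm_pow_mul_norm_fracLaplacian (u : Distribution n) {m : Fin n → ℤ}
    (hm : m ≠ 0) : (latticeNorm m)⁻¹ ^ n *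
      ‖fourierCoeff (fracLaplacian ((n : ℝ≥0) / 4) u) m‖ ^ 2 = ‖fourierCoeff u m‖ ^ 2 := by
  have hr : 0 < latticeNorm m := zero_lt_one.trans_le (one_le_latticeNorm hm)
  have h1 : (latticeNorm m ^ (2 * (((n : ℝ≥0) / 4 : ℝ≥0) : ℝ))) ^ 2 = latticeNorm m ^ n := by
    rw [← Real.rpow_natCast, ← Real.rpow_mul hr.le, ← Real.rpow_natCast]
    congr 1
    push_cast
    ring
  rw [fracLaplacian, fourierCoeff_multiplier, norm_mul, mul_pow, Complex.norm_real,
    Real.norm_of_nonneg (Real.rpow_nonneg hr.le _), h1, ← mul_assoc, ← mul_pow,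
    inv_mul_cancel₀ hr.ne', one_pow, one_mul]

theorem fourierCoeff_mean (u : Distribution n) (m : Fin n → ℤ) :
    fourierCoeff (mean u) m = if m = 0 then fourierCoeff u 0 else 0 := by
  have h := integral_character_mul_character_neg 0 m
  simp only [character_zero, one_mul] at h
  rw [mean, fourierCoeff_ofIntegrable, integral_const_mul, h, fourierCoeff, neg_zero]
  simp only [eq_comm (a := (0 : Fin n → ℤ))]
  split_ifs
  · field_simp [two_pi_pow_ne_zero n]
  · simp

end

end TorusDist

/-! ### Conclusion: the `L²` function and its norm -/

theorem mainTheorem4 (n : ℕ) (hn : 1 ≤ n) :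
    ∃ C : ℝ, 0 < C ∧ ∀ u : TorusDist.Distribution n,
      TorusDist.MemSum (-((n : ℝ) / 2)) (TorusDist.fracLaplacian ((n : ℝ≥0) / 4) u) →
      (∀ j : Fin n, TorusDist.MemSum (-((n : ℝ) / 2))
        (TorusDist.riesz j (TorusDist.fracLaplacian ((n : ℝ≥0) / 4) u))) →
      ∃ (f : TorusDist.Torus n → ℂ) (hf : MemLp f 2 volume),
        u - TorusDist.mean u = TorusDist.ofIntegrable f (hf.integrable one_le_two) ∧
        (∫ x, f x) = 0 ∧
        eLpNorm f 2 volume ≤ ENNReal.ofReal C *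
          (TorusDist.sumNorm (-((n : ℝ) / 2)) (TorusDist.fracLaplacian ((n : ℝ≥0) / 4) u) +
            ∑ j : Fin n, TorusDist.sumNorm (-((n : ℝ) / 2))
              (TorusDist.riesz j (TorusDist.fracLaplacian ((n : ℝ≥0) / 4) u))) := by
  classical
  obtain ⟨A, hA, hmain⟩ := TorusDist.exists_sum_inv_latticeNorm_pow_mul_le hn
  refine ⟨Real.sqrt ((2 * Real.pi) ^ n * A), Real.sqrt_pos.2 (by positivity), ?_⟩
  intro u hu hRu
  set C := Real.sqrt ((2 * Real.pi) ^ n * A) with hC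
  have hC0 : 0 < C := Real.sqrt_pos.2 (by positivity)
  set v := TorusDist.fracLaplacian ((n : ℝ≥0) / 4) u with hv
  set a : (Fin n → ℤ) → ℂ := fun m => if m = 0 then 0 else TorusDist.fourierCoeff u m with ha
  -- The infima defining the norms are replaced by decompositions within `ε`, one for `v` and one
  -- for each of the `n` Riesz transforms.
  have hbound : ∀ ε : ℝ≥0∞, ε ≠ 0 → ∃ T : ℝ, 0 ≤ T ∧
      (∀ F : Finset (Fin n → ℤ), ∑ m ∈ F, ‖a m‖ ^ 2 ≤ A * T ^ 2) ∧
      ENNReal.ofReal T ≤ (TorusDist.sumNorm (-((n : ℝ) / 2)) v + ε) +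
        ∑ j : Fin n, (TorusDist.sumNorm (-((n : ℝ) / 2)) (TorusDist.riesz j v) + ε) := by
    intro ε hε
    obtain ⟨g₀, hg₀, h₀, hv₀, hh₀, hle₀⟩ := TorusDist.exists_decomposition_le hu hε
    choose g hg h hvj hh hle using fun j => TorusDist.exists_decomposition_le (hRu j) hε
    have h1 : ∀ (g : TorusDist.Torus n → ℂ) (x : ℝ≥0∞), 0 ≤ (∫ x, ‖g x‖) + x.toReal :=
      fun g x => add_nonneg (integral_nonneg fun _ => norm_nonneg _) ENNReal.toReal_nonneg
    have h2 : 0 ≤ ∑ j, ((∫ x, ‖g j x‖) +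
        (TorusDist.sobolevNorm (-((n : ℝ) / 2)) (h j)).toReal) :=
      Finset.sum_nonneg fun j _ => h1 _ _
    refine ⟨_, add_nonneg (h1 g₀ (TorusDist.sobolevNorm (-((n : ℝ) / 2)) h₀)) h2, fun F => ?_, ?_⟩
    · refine le_trans (le_of_eq ?_) (hmain v g₀ hg₀ h₀ hv₀ hh₀ g hg h hvj hh (F.erase 0)
        fun m hm => Finset.ne_of_mem_erase hm)
      rw [← Finset.sum_erase F (a := 0) (by simp [ha])]
      refine Finset.sum_congr rfl fun m hm => ?_
      have hm0 := Finset.ne_of_mem_erase hm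
      rw [TorusDist.inv_latticeNorm_pow_mul_norm_fracLaplacian u hm0, ha]
      simp only [if_neg hm0]
    · rw [ENNReal.ofReal_add (h1 _ _) h2, ENNReal.ofReal_sum_of_nonneg fun j _ => h1 _ _]
      exact add_le_add hle₀ (Finset.sum_le_sum fun j _ => hle j)
  -- The choice `ε = 1` serves only for square summability, so `f` is fixed before `ε` tends to
  -- zero.
  obtain ⟨T, -, hT, -⟩ := hbound 1 one_ne_zero
  obtain ⟨f, hf, hcoeff, hnorm⟩ := TorusDist.exists_memLp_fourierCoeff_eq a
    (summable_of_sum_le (fun m => sq_nonneg _) hT)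
  refine ⟨f, hf, TorusDist.ext_fourierCoeff fun m => ?_, ?_, ?_⟩
  · rw [hcoeff, TorusDist.fourierCoeff_sub, TorusDist.fourierCoeff_mean, ha]
    by_cases hm : m = 0
    · simp [hm]
    · simp [hm]
  · have h0 := hcoeff 0
    rw [TorusDist.fourierCoeff_ofIntegrable] at h0
    simpa [ha, TorusDist.character_zero, Real.pi_ne_zero] using h0
  · refine ENNReal.le_of_forall_pos_le_add fun ε hε _ => ?_
    have hD : ENNReal.ofReal C * (n + 1) ≠ 0 :=
      mul_ne_zero (ENNReal.ofReal_pos.2 hC0).ne' (by positivity)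
    have hD' : ENNReal.ofReal C * (n + 1) ≠ ⊤ :=
      ENNReal.mul_ne_top ENNReal.ofReal_ne_top (by simp)
    -- There are `n + 1` errors, each multiplied by `C`; this choice makes their total equal to `ε`.
    obtain ⟨T, hT0, hT, hTle⟩ := hbound (ε / (ENNReal.ofReal C * (n + 1)))
      (ENNReal.div_ne_zero.2 ⟨by exact_mod_cast hε.ne', hD'⟩)
    refine (hnorm _ hT).trans ?_
    rw [← mul_assoc, Real.sqrt_mul (by positivity), Real.sqrt_sq hT0, ← hC,
      ENNReal.ofReal_mul hC0.le]
    refine (mul_le_mul_right hTle _).trans (le_of_eq ?_)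
    rw [Finset.sum_add_distrib, Finset.sum_const, Finset.card_univ, Fintype.card_fin, nsmul_eq_mul]
    set δ := (ε : ℝ≥0∞) / (ENNReal.ofReal C * (n + 1)) with hδ
    have hδ' : ENNReal.ofReal C * (n + 1) * δ = ε := ENNReal.mul_div_cancel hD hD'
    rw [← hδ']
    ring
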